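/- Call a set $Q\subseteq\mathbb Z$ a \emph{Kazhdan set} if there exists $\varepsilon>0$ such that every unitary operator $U$ on a complex separable Hilbert space $H$ for which there is $x\in H$ with $\|x\|=1$ and $\sup_{n\in Q}\|U^nx-x\|<\varepsilon$ has $1$ as an eigenvalue; call a sequence of integers $(n_k)_{k\ge0}$ \emph{Kazhdan} if the set $\{n_k:k\ge0\}$ is Kazhdan. A set $D\subseteq\mathbb Z$ is an \emph{asymptotic basis} of $\mathbb Z$ if there is an integer $r\ge1$ such that all but finitely many integers $m$ can be written as $m=\sum_{i=1}^r\varepsilon_id_i$ with $d_i\in D$ (repetitions allowed) and $\varepsilon_i=\pm1$. A set $B\subseteq\mathbb Z$ has \emph{density zero} if $\#(B\cap[-N,N])/(2N+1)\to0$ as $N\to\infty$. Let $(p_n)_{n\ge1}$ be a sequence of real numbers with $0<p_n<1$ for all $n$, such that (1) $\frac1{\log N}\sum_{n=1}^Np_n\to\infty$ as $N\to\infty$; (2) $\sum_{n=1}^N|p_{n+1}-p_n|=o\bigl(\sum_{n=1}^Np_n\bigr)$ as $N\to\infty$; (3) for every $\varepsilon\in(0,1)$, $p_n=O\bigl(n^{-(1-\varepsilon)}\bigr)$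 as $n\to\infty$. Let $(\xi_n)_{n\ge1}$ be independent random variables on a probability space $(\Omega,\mathcal F,\mathbb P)$ with $\mathbb P(\xi_n=1)=p_n$ and $\mathbb P(\xi_n=0)=1-p_n$ for every $n\ge1$, and let $A(\omega)=\{n\ge1:\xi_n(\omega)=1\}$. Then, almost surely, $A(\omega)$ is infinite and its increasing enumeration $(n_k)_{k\ge0}=(n_k(\omega))_{k\ge0}$ has the following properties: $(n_k)$ is a Kazhdan sequence; for each integer $r\ge1$, the set $B_r$ of all integers $m$ which can be written as $m=\sum_{i=1}^r\varepsilon_in_{k_i}$ with indices $k_i\ge0$ (repetitions allowed) and $\varepsilon_i=\pm1$ has density zero; and $\{n_k:k\ge0\}$ is not an asymptotic basis of $\mathbb Z$. In particular, there exist Kazhdan subsets of $\mathbb Z$ which are not asymptotic bases of $\mathbb Z$. -/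

import Mathlib

open MeasureTheory ProbabilityTheory Filter Topology Asymptotics

/-- `Q ⊆ ℤ` is a Kazhdan set: there is `ε > 0` such that every unitary operator `U` on a complex
separable Hilbert space having a unit vector `x` with `sup_{n ∈ Q} ‖Uⁿ x - x‖ < ε` has `1` as an
eigenvalue. The strict inequality for the supremum is written as a uniform bound `δ < ε`.
Every separable Hilbert space is unitarily equivalent to one whose underlying type lies in `Type`
(some `ℓ²(ι)` with `ι` countable), so that `H : Type` is no restriction. -/
def IsKazhdanSet (Q : Set ℤ) : Prop :=
  ∃ ε : ℝ, 0 < ε ∧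
    ∀ (H : Type) [NormedAddCommGroup H] [InnerProductSpace ℂ H] [CompleteSpace H]
      [TopologicalSpace.SeparableSpace H] (U : H ≃ₗᵢ[ℂ] H),
      (∃ x : H, ‖x‖ = 1 ∧ ∃ δ : ℝ, δ < ε ∧ ∀ n ∈ Q, ‖(U ^ n) x - x‖ ≤ δ) →
        ∃ y : H, y ≠ 0 ∧ U y = y

/-- A sequence of integers is Kazhdan if the set of its terms is a Kazhdan set. -/
def IsKazhdanSeq (n : ℕ → ℤ) : Prop :=
  IsKazhdanSet (Set.range n)

/-- The set of all integers `∑_{i=1}^r ε_i d_i` with `d_i ∈ D` (repetitions allowed) and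
`ε_i = ±1`. -/
def signedSums (D : Set ℤ) (r : ℕ) : Set ℤ :=
  {m | ∃ s d : Fin r → ℤ, (∀ i, s i = 1 ∨ s i = -1) ∧ (∀ i, d i ∈ D) ∧ m = ∑ i, s i * d i}

/-- `D` is an asymptotic basis of `ℤ`: for some `r ≥ 1`, all but finitely many integers are signed
`r`-fold sums of elements of `D`. -/
def IsAsymptoticBasis (D : Set ℤ) : Prop :=
  ∃ r : ℕ, 1 ≤ r ∧ {m : ℤ | m ∉ signedSums D r}.Finite

/-- `B ⊆ ℤ` has density zero: `#(B ∩ [-N, N]) / (2N + 1) → 0` as `N → ∞`. -/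
def HasDensityZero (B : Set ℤ) : Prop :=
  Tendsto (fun N : ℕ => ((B ∩ Set.Icc (-(N : ℤ)) (N : ℤ)).ncard : ℝ) / (2 * (N : ℝ) + 1))
    atTop (𝓝 0)

/-- The random set `A(ω) = {n ≥ 1 : ξ_n(ω) = 1}`. -/
def randomSet {Ω : Type*} (ξ : ℕ → Ω → ℝ) (ω : Ω) : Set ℕ :=
  {n | 1 ≤ n ∧ ξ n ω = 1}

/-- The random sequence `(n_k(ω))_{k ≥ 0}`: the increasing enumeration of `A(ω)`
(meaningful when `A(ω)` is infinite). -/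
noncomputable def randomSeq {Ω : Type*} (ξ : ℕ → Ω → ℝ) (ω : Ω) (k : ℕ) : ℤ :=
  (Nat.nth (fun n => n ∈ randomSet ξ ω) k : ℕ)

/-! Write q_n for the probability of the n-th event and S_N for the sum of q_n over n ≤ N.

Kazhdan property. If U fixes no nonzero vector, the range of U - 1 is dense. On a coboundary Uy - y,
Abel summation bounds the q-weighted sum of the U^n by the total variation of q, which is o(S_N); so
the q-weighted averages of U^n x tend to 0. The indicator of the random set may replace q: a
Chernoff bound over a net of O(N²) points of the circle, together with S_N / log N → ∞ and
Borel–Cantelli, makes the random polynomial ∑ (1_A(n) - q_n) z^n almost surely o(S_N) uniformly in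
|z| = 1, and the spectral theorem carries this over to U. The averages of U^n x over A ∩ [1, N] thus
tend to 0, which is impossible if ‖U^n x - x‖ ≤ δ < 1 = ‖x‖ on A.

Sparsity. A nonzero signed r-fold sum is a + cM with M its largest surviving term, c ≠ 0 and a built
from fewer than r smaller terms. Since q_n = O(n^{-(1-ε)}) with ε small in terms of r, the expected
number of such representations, weighted by 1/(1+|m|), is finite. Hence 1/(1+|m|) is almost surely
summable over B_r, which forces density zero; and a density-zero set cannot be cofinite.

The existence statement follows by applying this to q_n = log(n+2)/(n+2). -/

/-! ### Averages of unitary operators and the Kazhdan criterion -/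

/-- A polynomial in a unitary operator has norm at most its supremum on the unit circle. -/
theorem LinearIsometryEquiv.norm_sum_smul_pow_apply_le {H : Type*} [NormedAddCommGroup H]
    [InnerProductSpace ℂ H] [CompleteSpace H] (U : H ≃ₗᵢ[ℂ] H) (s : Finset ℕ) (c : ℕ → ℂ) {C : ℝ}
    (hC : ∀ z : ℂ, ‖z‖ = 1 → ‖∑ n ∈ s, c n * z ^ n‖ ≤ C) (x : H) :
    ‖∑ n ∈ s, c n • (U ^ n) x‖ ≤ C * ‖x‖ := by
  set u : unitary (H →L[ℂ] H) := Unitary.linearIsometryEquiv.symm U with hu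
  set V : H →L[ℂ] H := (u : H →L[ℂ] H) with hV
  have hVU : ∀ y, V y = U y := fun y => by simp [hV, hu]
  have hpow : ∀ (n : ℕ) (y : H), (V ^ n) y = (U ^ n) y := by
    intro n
    induction n with
    | zero => intro y; simp
    | succ n ih => intro y; rw [pow_succ, pow_succ]; simp [ih, hVU]
  have hVu : V ∈ unitary (H →L[ℂ] H) := u.2
  have hn : IsStarNormal V := by infer_instance
  set f : Polynomial ℂ := ∑ n ∈ s, Polynomial.C (c n) * Polynomial.X ^ n with hf
  have heval : ∀ z : ℂ, f.eval z = ∑ n ∈ s, c n * z ^ n := fun z => by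
    simp [hf, Polynomial.eval_finsetSum]
  have haev : Polynomial.aeval V f = ∑ n ∈ s, c n • V ^ n := by
    simp [hf, Algebra.smul_def]
  have hC0 : 0 ≤ C := (norm_nonneg _).trans (hC 1 (by simp))
  have hnorm : ‖Polynomial.aeval V f‖ ≤ C := by
    -- A unitary is normal with spectrum in the circle, so the functional calculus bounds the norm
    -- of the polynomial by its supremum there.
    rw [← cfc_polynomial f V hn]
    refine norm_cfc_le hC0 fun z hz => ?_
    rw [heval]
    exact hC z (by simpa using spectrum.subset_circle_of_unitary hVu hz)
  have : ∑ n ∈ s, c n • (U ^ n) x = Polynomial.aeval V f x := by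
    rw [haev]; simp [hpow]
  rw [this]
  exact (ContinuousLinearMap.le_opNorm _ _).trans (by gcongr)

/-- If `U` has no nonzero fixed vector then the range of `U - 1` is dense. -/
theorem LinearIsometryEquiv.exists_norm_sub_coboundary_lt {H : Type*} [NormedAddCommGroup H]
    [InnerProductSpace ℂ H] [CompleteSpace H] (U : H ≃ₗᵢ[ℂ] H) (hU : ∀ y, U y = y → y = 0)
    (x : H) {η : ℝ} (hη : 0 < η) : ∃ y, ‖x - (U y - y)‖ < η := by
  set R : Submodule ℂ H := LinearMap.range ((U.toLinearEquiv : H →ₗ[ℂ] H) - 1) with hR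
  have hbot : Rᗮ = ⊥ := by
    rw [Submodule.eq_bot_iff]
    intro v hv
    -- A vector orthogonal to the range satisfies ⟨Uv, v⟩ = ‖v‖²; since ‖Uv‖ = ‖v‖, this is equality
    -- in Cauchy–Schwarz and forces Uv = v.
    refine hU v (eq_of_norm_le_re_inner_eq_norm_sq (𝕜 := ℂ) (by simp) ?_)
    have : ∀ y, inner ℂ (U y) v = inner ℂ y v := by
      simpa [hR, Submodule.mem_orthogonal, inner_sub_left, sub_eq_zero] using hv
    simp [this, ← Complex.ofReal_pow]
  have hdense : R.topologicalClosure = ⊤ := by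
    rwa [Submodule.topologicalClosure_eq_top_iff]
  have hx : x ∈ closure (R : Set H) := by
    rw [← Submodule.topologicalClosure_coe, hdense]; trivial
  obtain ⟨b, hb, hxb⟩ := Metric.mem_closure_iff.1 hx η hη
  obtain ⟨y, rfl⟩ := hb
  exact ⟨y, by simpa [dist_eq_norm] using hxb⟩

/-- Abel summation: the differences move from the orbit `g` to the weights `q`, whose variation is
controlled. -/
theorem Finset.sum_Icc_smul_sub_eq {H : Type*} [AddCommGroup H] [Module ℝ H] (q : ℕ → ℝ)
    (g : ℕ → H) (N : ℕ) :
    ∑ n ∈ Finset.Icc 1 N, q n • (g (n + 1) - g n) =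
      q (N + 1) • g (N + 1) - q 1 • g 1
        - ∑ n ∈ Finset.Icc 1 N, (q (n + 1) - q n) • g (n + 1) := by
  induction N with
  | zero => simp
  | succ N ih =>
    rw [Finset.sum_Icc_succ_top (by omega), Finset.sum_Icc_succ_top (by omega), ih]
    module

/-- Slowly varying weighted averages of a unitary without fixed vectors tend to zero. -/
theorem LinearIsometryEquiv.eventually_norm_sum_smul_le {H : Type*} [NormedAddCommGroup H]
    [InnerProductSpace ℂ H] [CompleteSpace H] (U : H ≃ₗᵢ[ℂ] H) (hU : ∀ y, U y = y → y = 0)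
    {q : ℕ → ℝ} (hq : ∀ n, 1 ≤ n → 0 ≤ q n ∧ q n ≤ 1)
    (hP : Tendsto (fun N : ℕ => ∑ n ∈ Finset.Icc 1 N, q n) atTop atTop)
    (hvar : (fun N : ℕ => ∑ n ∈ Finset.Icc 1 N, |q (n + 1) - q n|) =o[atTop]
      (fun N : ℕ => ∑ n ∈ Finset.Icc 1 N, q n))
    (x : H) {η : ℝ} (hη : 0 < η) :
    ∀ᶠ N : ℕ in atTop, ‖∑ n ∈ Finset.Icc 1 N, ((q n : ℝ) : ℂ) • (U ^ n) x‖
      ≤ η * ∑ n ∈ Finset.Icc 1 N, q n := by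
  obtain ⟨y, hy⟩ := U.exists_norm_sub_coboundary_lt hU x (half_pos hη)
  -- Of the budget η, half goes to approximating `x` by a coboundary, a quarter to the variation of
  -- `q` and a quarter to the two boundary terms. The `+ 1` covers `y = 0`.
  have hc : 0 < η / (4 * (‖y‖ + 1)) := by positivity
  filter_upwards [hvar.bound hc, hP.eventually_ge_atTop (8 * (‖y‖ + 1) / η)] with N h1 h2
  set S := ∑ n ∈ Finset.Icc 1 N, q n with hS
  have hS0 : 0 ≤ S := Finset.sum_nonneg fun n hn => (hq n (Finset.mem_Icc.1 hn).1).1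
  have hUn : ∀ (n : ℕ) (v : H), ‖(U ^ n) v‖ = ‖v‖ := fun n v => (U ^ n).norm_map v
  have hsplit : ∑ n ∈ Finset.Icc 1 N, ((q n : ℝ) : ℂ) • (U ^ n) x
      = ∑ n ∈ Finset.Icc 1 N, ((q n : ℝ) : ℂ) • (U ^ n) (x - (U y - y))
        + ∑ n ∈ Finset.Icc 1 N, (q n) • ((U ^ (n + 1)) y - (U ^ n) y) := by
    rw [← Finset.sum_add_distrib]
    refine Finset.sum_congr rfl fun n _ => ?_
    have : (U ^ (n + 1)) y = (U ^ n) (U y) := by rw [pow_succ]; rfl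
    rw [this, ← Complex.coe_smul, ← smul_add, map_sub, map_sub]
    congr 1; abel
  have hA : ‖∑ n ∈ Finset.Icc 1 N, ((q n : ℝ) : ℂ) • (U ^ n) (x - (U y - y))‖ ≤ η / 2 * S := by
    rw [hS, Finset.mul_sum]
    refine norm_sum_le_of_le _ fun n hn => ?_
    have := (hq n (Finset.mem_Icc.1 hn).1).1
    rw [norm_smul, hUn, Complex.norm_real, Real.norm_of_nonneg this, mul_comm]
    gcongr
  have hB : ‖∑ n ∈ Finset.Icc 1 N, (q n) • ((U ^ (n + 1)) y - (U ^ n) y)‖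
      ≤ (2 + ∑ n ∈ Finset.Icc 1 N, |q (n + 1) - q n|) * ‖y‖ := by
    rw [Finset.sum_Icc_smul_sub_eq q (fun n => (U ^ n) y) N]
    have e1 : ‖q (N + 1) • (U ^ (N + 1)) y‖ ≤ 1 * ‖y‖ := by
      obtain ⟨h0, h1⟩ := hq (N + 1) (by omega)
      rw [norm_smul, hUn, Real.norm_of_nonneg h0]; gcongr
    have e2 : ‖q 1 • (U ^ 1) y‖ ≤ 1 * ‖y‖ := by
      obtain ⟨h0, h1⟩ := hq 1 le_rfl
      rw [norm_smul, hUn, Real.norm_of_nonneg h0]; gcongr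
    have e3 : ‖∑ n ∈ Finset.Icc 1 N, (q (n + 1) - q n) • (U ^ (n + 1)) y‖
        ≤ (∑ n ∈ Finset.Icc 1 N, |q (n + 1) - q n|) * ‖y‖ := by
      rw [Finset.sum_mul]
      refine norm_sum_le_of_le _ fun n _ => ?_
      rw [norm_smul, hUn, Real.norm_eq_abs]
    have := norm_sub_le (q (N + 1) • (U ^ (N + 1)) y - q 1 • (U ^ 1) y)
      (∑ n ∈ Finset.Icc 1 N, (q (n + 1) - q n) • (U ^ (n + 1)) y)
    have := norm_sub_le (q (N + 1) • (U ^ (N + 1)) y) (q 1 • (U ^ 1) y)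
    linarith
  have hD0 : 0 ≤ ∑ n ∈ Finset.Icc 1 N, |q (n + 1) - q n| :=
    Finset.sum_nonneg fun _ _ => abs_nonneg _
  rw [Real.norm_of_nonneg hD0, Real.norm_of_nonneg hS0] at h1
  have hyp : 0 < ‖y‖ + 1 := by positivity
  have hB1 : (2 + ∑ n ∈ Finset.Icc 1 N, |q (n + 1) - q n|) * ‖y‖ ≤ η / 2 * S := by
    have k1 : 8 * (‖y‖ + 1) ≤ S * η := (div_le_iff₀ hη).1 h2
    have k2 : (∑ n ∈ Finset.Icc 1 N, |q (n + 1) - q n|) * (‖y‖ + 1) ≤ η / 4 * S := by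
      calc _ ≤ η / (4 * (‖y‖ + 1)) * S * (‖y‖ + 1) := by gcongr
        _ = _ := by field_simp
    nlinarith [norm_nonneg y]
  rw [hsplit]
  refine (norm_add_le _ _).trans ?_
  linarith

/-- A set of positive integers whose indicator is uniformly close, on average and on the unit
circle, to a slowly varying weight is a Kazhdan set. -/
theorem isKazhdanSet_of_uniform_average {A : Set ℕ} {a q : ℕ → ℝ}
    (ha : ∀ n, a n = A.indicator 1 n) (hq : ∀ n, 1 ≤ n → 0 ≤ q n ∧ q n ≤ 1)
    (hP : Tendsto (fun N : ℕ => ∑ n ∈ Finset.Icc 1 N, q n) atTop atTop)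
    (hvar : (fun N : ℕ => ∑ n ∈ Finset.Icc 1 N, |q (n + 1) - q n|) =o[atTop]
      (fun N : ℕ => ∑ n ∈ Finset.Icc 1 N, q n))
    (hunif : ∀ η : ℝ, 0 < η → ∀ᶠ N : ℕ in atTop, ∀ z : ℂ, ‖z‖ = 1 →
      ‖∑ n ∈ Finset.Icc 1 N, ((a n - q n : ℝ) : ℂ) * z ^ n‖ ≤ η * ∑ n ∈ Finset.Icc 1 N, q n) :
    IsKazhdanSet ((fun n : ℕ => (n : ℤ)) '' A) := by
  -- The constant 1 = ‖x‖ suffices: below it, the vectors U^n x with n ∈ A stay near `x` and cannot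
  -- cancel on average.
  refine ⟨1, one_pos, ?_⟩
  intro H _ _ _ _ U ⟨x, hx, δ, hδ, hQ⟩
  by_contra! hno
  have hU : ∀ y, U y = y → y = 0 := fun y hy => by
    by_contra h; exact hno y h hy
  set κ : ℝ := 1 - max δ 0 with hκ
  have hκ0 : 0 < κ := by rw [hκ, sub_pos]; exact max_lt hδ one_pos
  have hκ1 : κ ≤ 1 := by rw [hκ]; linarith [le_max_right δ 0]
  have hη : 0 < κ / 8 := by positivity
  obtain ⟨N, h1, h2, h3⟩ := ((U.eventually_norm_sum_smul_le hU hq hP hvar x hη).and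
    ((hunif _ hη).and (hP.eventually_gt_atTop 0))).exists
  set S := ∑ n ∈ Finset.Icc 1 N, q n with hS
  have ha0 : ∀ n, 0 ≤ a n := fun n => by
    rw [ha]; exact Set.indicator_nonneg (fun _ _ => zero_le_one) _
  have hone : |∑ n ∈ Finset.Icc 1 N, a n - S| ≤ κ / 8 * S := by
    have := h2 1 (by simp)
    simp only [one_pow, mul_one] at this
    rw [← Complex.ofReal_sum, Complex.norm_real, Finset.sum_sub_distrib, Real.norm_eq_abs] at this
    exact this
  have hT : (1 - κ / 8) * S ≤ ∑ n ∈ Finset.Icc 1 N, a n := by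
    linarith [(abs_le.1 hone).1]
  set T := ∑ n ∈ Finset.Icc 1 N, a n with hTdef
  have hup : ‖∑ n ∈ Finset.Icc 1 N, ((a n : ℝ) : ℂ) • (U ^ n) x‖ ≤ κ / 4 * S := by
    have h4 := U.norm_sum_smul_pow_apply_le (Finset.Icc 1 N) (fun n => ((a n - q n : ℝ) : ℂ)) h2 x
    have : ∑ n ∈ Finset.Icc 1 N, ((a n : ℝ) : ℂ) • (U ^ n) x
      = ∑ n ∈ Finset.Icc 1 N, ((a n - q n : ℝ) : ℂ) • (U ^ n) x
        + ∑ n ∈ Finset.Icc 1 N, ((q n : ℝ) : ℂ) • (U ^ n) x := by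
      rw [← Finset.sum_add_distrib]
      refine Finset.sum_congr rfl fun n _ => ?_
      rw [← add_smul]; simp
    rw [this]
    refine (norm_add_le _ _).trans ?_
    rw [hx] at h4
    linarith
  have hlow : κ * T ≤ ‖∑ n ∈ Finset.Icc 1 N, ((a n : ℝ) : ℂ) • (U ^ n) x‖ := by
    have e1 : ‖∑ n ∈ Finset.Icc 1 N, ((a n : ℝ) : ℂ) • ((U ^ n) x - x)‖ ≤ T * max δ 0 := by
      rw [hTdef, Finset.sum_mul]
      refine norm_sum_le_of_le _ fun n _ => ?_
      rw [norm_smul, Complex.norm_real, Real.norm_of_nonneg (ha0 n)]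
      by_cases hn : n ∈ A
      · have := hQ n ⟨n, hn, rfl⟩
        rw [zpow_natCast] at this
        exact mul_le_mul_of_nonneg_left (this.trans (le_max_left _ _)) (ha0 n)
      · simp [ha, hn]
    have e2 : ‖∑ n ∈ Finset.Icc 1 N, ((a n : ℝ) : ℂ) • x‖ = T := by
      rw [← Finset.sum_smul, norm_smul, hx, mul_one, ← Complex.ofReal_sum, Complex.norm_real,
        Real.norm_of_nonneg (Finset.sum_nonneg fun n _ => ha0 n)]
    have e3 : ∑ n ∈ Finset.Icc 1 N, ((a n : ℝ) : ℂ) • ((U ^ n) x - x)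
        = ∑ n ∈ Finset.Icc 1 N, ((a n : ℝ) : ℂ) • (U ^ n) x
          - ∑ n ∈ Finset.Icc 1 N, ((a n : ℝ) : ℂ) • x := by
      rw [← Finset.sum_sub_distrib]
      exact Finset.sum_congr rfl fun n _ => smul_sub _ _ _
    rw [e3] at e1
    have := norm_sub_norm_le (∑ n ∈ Finset.Icc 1 N, ((a n : ℝ) : ℂ) • x)
      (∑ n ∈ Finset.Icc 1 N, ((a n : ℝ) : ℂ) • (U ^ n) x)
    rw [norm_sub_rev, e2] at this
    have : κ * T = T - T * max δ 0 := by rw [hκ]; ring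
    linarith
  -- As κ ≤ 1, the lower bound κT is at least (7/8)κS, against the upper bound (1/4)κS with S > 0.
  nlinarith [mul_le_mul_of_nonneg_left hT hκ0.le, mul_pos hκ0 h3]

/-! ### Chernoff bounds and uniform smallness on the unit circle -/

/-- Exponential moments of a centred, weighted indicator. -/
theorem integral_exp_mul_indicator_sub_le {Ω : Type*} [MeasurableSpace Ω] {P : Measure Ω}
    [IsProbabilityMeasure P] {E : Set Ω} (hE : MeasurableSet E) {b t : ℝ} (hb : |b| ≤ 1)
    (ht : |t| ≤ 1) :
    Integrable (fun ω => Real.exp (t * (b * (E.indicator (fun _ => (1 : ℝ)) ω - P.real E)))) P ∧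
    mgf (fun ω => b * (E.indicator (fun _ => (1 : ℝ)) ω - P.real E)) P t
      ≤ Real.exp (t ^ 2 * P.real E) := by
  set q := P.real E with hq
  have hq0 : 0 ≤ q := measureReal_nonneg
  have hq1 : q ≤ 1 := measureReal_le_one
  -- Any function of an indicator is affine in it, so the exponential integrates explicitly. Below,
  -- e^u ≤ 1 + u + u² for |u| ≤ 1; the linear terms cancel by centring and the variance q(1-q) is at
  -- most q.
  have haff : (fun ω => Real.exp (t * (b * (E.indicator (fun _ => (1 : ℝ)) ω - q))))
      = fun ω => (Real.exp (t * b * (1 - q)) - Real.exp (t * b * (-q)))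
        * E.indicator (fun _ => (1 : ℝ)) ω + Real.exp (t * b * (-q)) := by
    funext ω
    by_cases h : ω ∈ E <;> simp [h, mul_assoc]
  have hind : Integrable (E.indicator (fun _ => (1 : ℝ))) P :=
    (integrable_const 1).indicator hE
  refine ⟨?_, ?_⟩
  · rw [haff]
    exact (hind.const_mul _).add (integrable_const _)
  · rw [mgf, haff, integral_add (hind.const_mul _) (integrable_const _), integral_const_mul,
      integral_indicator_const _ hE, integral_const]
    simp only [probReal_univ, smul_eq_mul, mul_one, one_mul, ← hq]
    have hs : |t * b| ≤ 1 := by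
      rw [abs_mul]; exact mul_le_one₀ ht (abs_nonneg _) hb
    have hs2 : (t * b) ^ 2 ≤ t ^ 2 := by
      rw [mul_pow, ← sq_abs b]
      exact mul_le_of_le_one_right (sq_nonneg _) (pow_le_one₀ (abs_nonneg _) hb)
    have key : ∀ u : ℝ, |u| ≤ 1 → Real.exp u ≤ 1 + u + u ^ 2 := fun u hu => by
      linarith [(abs_le.1 (Real.abs_exp_sub_one_sub_id_le hu)).2]
    set s := t * b with hsdef
    have k1 := key (s * (1 - q)) (by
      rw [abs_mul]; exact mul_le_one₀ hs (abs_nonneg _) (by rw [abs_le]; constructor <;> linarith))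
    have k2 := key (s * (-q)) (by
      rw [abs_mul]; exact mul_le_one₀ hs (abs_nonneg _) (by rw [abs_le]; constructor <;> linarith))
    have k3 : 1 + t ^ 2 * q ≤ Real.exp (t ^ 2 * q) := by
      linarith [Real.add_one_le_exp (t ^ 2 * q)]
    have m1 := mul_le_mul_of_nonneg_left k1 hq0
    have m2 := mul_le_mul_of_nonneg_left k2 (sub_nonneg.2 hq1)
    have m3 : s ^ 2 * (q * (1 - q)) ≤ t ^ 2 * q :=
      mul_le_mul hs2 (by nlinarith) (mul_nonneg hq0 (sub_nonneg.2 hq1)) (sq_nonneg _)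
    nlinarith

/-- **Chernoff bound** for weighted sums of independent centred indicators. -/
theorem ProbabilityTheory.iIndepSet.measureReal_le_sum_indicator_sub_le {Ω : Type*}
    [MeasurableSpace Ω] {P : Measure Ω} [IsProbabilityMeasure P] {E : ℕ → Set Ω}
    (hE : ∀ n, MeasurableSet (E n)) (hind : iIndepSet E P) {b : ℕ → ℝ} (hb : ∀ n, |b n| ≤ 1)
    (s : Finset ℕ) {η : ℝ} (hη0 : 0 < η) (hη1 : η ≤ 1) :
    P.real {ω | η * ∑ n ∈ s, P.real (E n) ≤
        ∑ n ∈ s, b n * ((E n).indicator (fun _ => (1 : ℝ)) ω - P.real (E n))}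
      ≤ Real.exp (-(η ^ 2 / 4) * ∑ n ∈ s, P.real (E n)) := by
  set Y : ℕ → Ω → ℝ := fun n ω => b n * ((E n).indicator (fun _ => (1 : ℝ)) ω - P.real (E n))
    with hY
  have hYind : iIndepFun Y P :=
    (hind.iIndepFun_indicator (β := ℝ)).comp (fun n x => b n * (x - P.real (E n)))
      (fun n => by fun_prop)
  have hYm : ∀ n, Measurable (Y n) := fun n =>
    ((measurable_const.indicator (hE n)).sub_const _).const_mul _
  -- The parameter t = η/2 minimises -tη + t², with value -η²/4.
  have ht0 : 0 ≤ η / 2 := by positivity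
  have ht1 : |η / 2| ≤ 1 := by rw [abs_of_nonneg ht0]; linarith
  have hint : Integrable (fun ω => Real.exp (η / 2 * (∑ n ∈ s, Y n) ω)) P :=
    hYind.integrable_exp_mul_sum hYm fun n _ =>
      (integral_exp_mul_indicator_sub_le (hE n) (hb n) ht1).1
  have h := measure_ge_le_exp_mul_mgf (μ := P) (X := ∑ n ∈ s, Y n)
    (η * ∑ n ∈ s, P.real (E n)) ht0 hint
  rw [hYind.mgf_sum hYm] at h
  have hprod : ∏ n ∈ s, mgf (Y n) P (η / 2) ≤ ∏ n ∈ s, Real.exp ((η / 2) ^ 2 * P.real (E n)) :=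
    Finset.prod_le_prod (fun _ _ => mgf_nonneg) fun n _ =>
      (integral_exp_mul_indicator_sub_le (hE n) (hb n) ht1).2
  rw [← Real.exp_sum, ← Finset.mul_sum] at hprod
  have h' := h.trans (mul_le_mul_of_nonneg_left hprod (Real.exp_nonneg _))
  rw [← Real.exp_add] at h'
  simp only [Finset.sum_apply] at h'
  refine h'.trans (le_of_eq ?_)
  congr 1; ring

theorem Complex.norm_exp_I_mul_sub_exp_I_mul_le (x y : ℝ) :
    ‖Complex.exp (Complex.I * x) - Complex.exp (Complex.I * y)‖ ≤ |x - y| := by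
  have : Complex.exp (Complex.I * x) - Complex.exp (Complex.I * y)
      = Complex.exp (Complex.I * y) * (Complex.exp (Complex.I * ((x - y : ℝ) : ℂ)) - 1) := by
    rw [mul_sub, ← Complex.exp_add, mul_one]
    congr 2
    push_cast; ring
  rw [this, norm_mul, mul_comm Complex.I, Complex.norm_exp_ofReal_mul_I, one_mul]
  exact Real.norm_exp_I_mul_ofReal_sub_one_le

/-- The `j`-th point of a uniform net on the unit circle. -/
noncomputable def circleNet (M : ℕ) (j : ℤ) : ℂ :=
  Complex.exp (Complex.I * ((2 * Real.pi * j / M : ℝ) : ℂ))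

theorem norm_circleNet (M : ℕ) (j : ℤ) : ‖circleNet M j‖ = 1 := by
  rw [circleNet, mul_comm, Complex.norm_exp_ofReal_mul_I]

/-- Rounding the argument down to the net costs at most 2π/M ≤ 7/M, and taking n-th powers
multiplies this by n. -/
theorem exists_circleNet_norm_pow_sub_le {M : ℕ} (hM : 0 < M) {z : ℂ} (hz : ‖z‖ = 1) :
    ∃ j ∈ Finset.Icc (-(M : ℤ)) M, ∀ n : ℕ, ‖z ^ n - circleNet M j ^ n‖ ≤ n * (7 / M) := by
  have hπ := Real.pi_pos
  have hM' : (0 : ℝ) < M := by exact_mod_cast hM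
  set θ := z.arg with hθ
  have hzθ : z = Complex.exp (Complex.I * θ) := by
    have := Complex.norm_mul_exp_arg_mul_I z
    rw [hz] at this
    rw [mul_comm]; simpa using this.symm
  have h1 := Complex.neg_pi_lt_arg z
  have h2 := Complex.arg_le_pi z
  set u : ℝ := θ * M / (2 * Real.pi) with hu
  have hu1 : -(M : ℝ) ≤ u := by
    rw [hu, le_div_iff₀ (by positivity)]; nlinarith
  have hu2 : u ≤ M := by
    rw [hu, div_le_iff₀ (by positivity)]; nlinarith
  refine ⟨⌊u⌋, Finset.mem_Icc.2 ⟨Int.le_floor.2 (by exact_mod_cast hu1), ?_⟩, fun n => ?_⟩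
  · have : (⌊u⌋ : ℝ) ≤ (M : ℝ) := (Int.floor_le u).trans hu2
    exact_mod_cast this
  · have e : ∀ x : ℝ, Complex.exp (Complex.I * x) ^ n = Complex.exp (Complex.I * ((n * x : ℝ) : ℂ)) :=
      fun x => by rw [← Complex.exp_nat_mul]; congr 1; push_cast; ring
    rw [hzθ, circleNet, e, e]
    refine (Complex.norm_exp_I_mul_sub_exp_I_mul_le _ _).trans ?_
    rw [← mul_sub, abs_mul, Nat.abs_cast]
    gcongr
    have hd : θ - 2 * Real.pi * ⌊u⌋ / M = 2 * Real.pi / M * (u - ⌊u⌋) := by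
      rw [hu]; field_simp
    have hf0 := Int.fract_nonneg u
    have hf1 := (Int.fract_lt_one u).le
    rw [Int.fract] at hf0 hf1
    rw [hd, abs_of_nonneg (by positivity)]
    calc 2 * Real.pi / M * (u - ⌊u⌋) ≤ 2 * Real.pi / M * 1 := by gcongr
      _ ≤ 7 / M := by rw [mul_one]; gcongr; linarith [Real.pi_lt_d2]

/-- One-sided real bounds in four directions control |Re Z| and |Im Z|, so the one-sided Chernoff
bound is enough. -/
theorem Complex.norm_le_of_re_mul_le {Z : ℂ} {c : ℝ}
    (h : ∀ w ∈ ({1, -1, Complex.I, -Complex.I} : Finset ℂ), (w * Z).re ≤ c) : ‖Z‖ ≤ 2 * c := by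
  have h1 := h 1 (by simp)
  have h2 := h (-1) (by simp)
  have h3 := h Complex.I (by simp)
  have h4 := h (-Complex.I) (by simp)
  simp at h1 h2 h3 h4
  have := Complex.norm_le_abs_re_add_abs_im Z
  have a1 : |Z.re| ≤ c := abs_le.2 ⟨by linarith, h1⟩
  have a2 : |Z.im| ≤ c := abs_le.2 ⟨by linarith, by linarith⟩
  linarith

/-- Almost surely, the random trigonometric polynomials attached to independent events are
uniformly small on the unit circle relative to the expected number of events. -/
theorem ProbabilityTheory.iIndepSet.ae_eventually_norm_sum_le {Ω : Type*}
    [MeasurableSpace Ω] {P : Measure Ω} [IsProbabilityMeasure P] {E : ℕ → Set Ω}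
    (hE : ∀ n, MeasurableSet (E n)) (hind : iIndepSet E P)
    (hlog : Tendsto (fun N : ℕ => (1 / Real.log (N : ℝ)) * ∑ n ∈ Finset.Icc 1 N, P.real (E n))
        atTop atTop)
    {η : ℝ} (hη0 : 0 < η) (hη1 : η ≤ 1) :
    ∀ᵐ ω ∂P, ∀ᶠ N : ℕ in atTop, ∀ z : ℂ, ‖z‖ = 1 →
      ‖∑ n ∈ Finset.Icc 1 N,
        (((E n).indicator (fun _ => (1 : ℝ)) ω - P.real (E n) : ℝ) : ℂ) * z ^ n‖
        ≤ 3 * η * ∑ n ∈ Finset.Icc 1 N, P.real (E n) := by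
  obtain ⟨K, hK⟩ := exists_nat_ge (7 / η)
  have hK0 : 0 < K := by
    have : (0 : ℝ) < K := lt_of_lt_of_le (by positivity) hK
    exact_mod_cast this
  set W : Finset ℂ := {1, -1, Complex.I, -Complex.I} with hW
  set S : ℕ → ℝ := fun N => ∑ n ∈ Finset.Icc 1 N, P.real (E n) with hS
  set X : ℕ → Ω → ℝ := fun n ω => (E n).indicator (fun _ => (1 : ℝ)) ω - P.real (E n) with hX
  -- With this mesh, replacing z by a net point changes each of the N terms by at most N · 7/(KN²),
  -- hence the sum by at most 7/K ≤ η.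
  set M : ℕ → ℕ := fun N => K * N ^ 2 with hM
  set J : ℕ → Finset (ℂ × ℤ) := fun N => W ×ˢ Finset.Icc (-(M N : ℤ)) (M N) with hJ
  set G : ℕ → ℂ × ℤ → Set Ω := fun N i => {ω | η * S N ≤
    ∑ n ∈ Finset.Icc 1 N, (i.1 * circleNet (M N) i.2 ^ n).re * X n ω} with hG
  set F : ℕ → Set Ω := fun N => ⋃ i ∈ J N, G N i with hF
  have hWn : ∀ w ∈ W, ‖w‖ = 1 := by
    intro w hw
    simp only [hW, Finset.mem_insert, Finset.mem_singleton] at hw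
    rcases hw with rfl | rfl | rfl | rfl <;> simp
  -- The factor 16/η² turns exp(-η²S/4) into N⁻⁴, which beats the O(N²) events of the union bound
  -- and leaves the summable N⁻². The bound 1 ≤ S absorbs the net error η into ηS.
  have hlarge : ∀ᶠ N : ℕ in atTop, 16 / η ^ 2 * Real.log N ≤ S N ∧ 1 ≤ S N := by
    filter_upwards [hlog.eventually_ge_atTop (16 / η ^ 2), eventually_ge_atTop 3] with N h1 h3
    have h3' : (3 : ℝ) ≤ N := by exact_mod_cast h3
    have hl : 1 ≤ Real.log N := by
      rw [Real.le_log_iff_exp_le (by linarith)]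
      linarith [Real.exp_one_lt_d9]
    have h4 : 16 / η ^ 2 * Real.log N ≤ S N := by
      rw [one_div, inv_mul_eq_div, le_div_iff₀ (by linarith)] at h1
      exact h1
    refine ⟨h4, le_trans ?_ h4⟩
    have : 1 ≤ 16 / η ^ 2 := by
      rw [le_div_iff₀ (by positivity)]; nlinarith
    nlinarith
  have hGle : ∀ N, ∀ i ∈ J N, P.real (G N i) ≤ Real.exp (-(η ^ 2 / 4) * S N) := by
    intro N i hi
    refine hind.measureReal_le_sum_indicator_sub_le hE (fun n => ?_) (Finset.Icc 1 N) hη0 hη1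
    refine (Complex.abs_re_le_norm _).trans ?_
    rw [norm_mul, norm_pow, norm_circleNet, hWn _ (Finset.mem_product.1 hi).1]
    simp
  have hcard : ∀ N, ((J N).card : ℝ) ≤ 4 * (2 * (K * N ^ 2) + 1) := by
    intro N
    rw [hJ, Finset.card_product, Int.card_Icc]
    have h4 : W.card ≤ 4 := Finset.card_le_four
    have : ((M N : ℤ) + 1 - -(M N : ℤ)).toNat = 2 * (K * N ^ 2) + 1 := by
      simp only [hM]; omega
    rw [this]
    exact_mod_cast Nat.mul_le_mul_right _ h4
  have hFle : ∀ᶠ N : ℕ in atTop, ‖P.real (F N)‖ ≤ 4 * (2 * K + 1) * (1 / (N : ℝ) ^ 2) := by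
    filter_upwards [hlarge, eventually_ge_atTop 1] with N h1 hN
    have hN' : (1 : ℝ) ≤ N := by exact_mod_cast hN
    rw [Real.norm_of_nonneg measureReal_nonneg]
    have hexp : Real.exp (-(η ^ 2 / 4) * S N) ≤ 1 / (N : ℝ) ^ 4 := by
      have : -(η ^ 2 / 4) * S N ≤ -(4 * Real.log N) := by
        have := mul_le_mul_of_nonneg_left h1.1 (show 0 ≤ η ^ 2 / 4 by positivity)
        have e : η ^ 2 / 4 * (16 / η ^ 2 * Real.log N) = 4 * Real.log N := by
          field_simp; norm_num
        linarith
      refine (Real.exp_le_exp.2 this).trans (le_of_eq ?_)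
      rw [Real.exp_neg, one_div]
      congr 1
      rw [show (4 : ℝ) * Real.log N = ((4 : ℕ) : ℝ) * Real.log N by norm_num, ← Real.log_pow,
        Real.exp_log (by positivity)]
    calc P.real (F N) ≤ ∑ i ∈ J N, P.real (G N i) := measureReal_biUnion_finset_le _ _
      _ ≤ (J N).card • Real.exp (-(η ^ 2 / 4) * S N) := Finset.sum_le_card_nsmul _ _ _ (hGle N)
      _ ≤ 4 * (2 * (K * N ^ 2) + 1) * (1 / (N : ℝ) ^ 4) := by
          rw [nsmul_eq_mul]
          exact mul_le_mul (hcard N) hexp (Real.exp_nonneg _) (by positivity)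
      _ ≤ 4 * (2 * K * N ^ 2 + N ^ 2) * (1 / (N : ℝ) ^ 4) := by
          have : (1 : ℝ) ≤ (N : ℝ) ^ 2 := one_le_pow₀ hN'
          gcongr ?_ * _
          linarith
      _ = _ := by field_simp
  have hsum : Summable fun N => P.real (F N) := by
    refine Summable.of_norm_bounded_eventually_nat ?_ hFle
    exact (Real.summable_one_div_nat_pow.2 (by norm_num)).mul_left _
  have hne : ∑' N, P (F N) ≠ ⊤ := by
    have := hsum.tsum_ofReal_ne_top
    simpa [measureReal_def, ENNReal.ofReal_toReal (measure_ne_top P _)] using this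
  filter_upwards [ae_eventually_notMem hne] with ω hω
  filter_upwards [hω, hlarge, eventually_ge_atTop 1] with N hN hN1 hNpos z hz
  have hNR : (0 : ℝ) < N := by exact_mod_cast hNpos
  have hKR : (0 : ℝ) < K := by exact_mod_cast hK0
  have hMpos : 0 < M N := by simp only [hM]; positivity
  obtain ⟨j, hj, hjn⟩ := exists_circleNet_norm_pow_sub_le hMpos hz
  have hnet : ‖∑ n ∈ Finset.Icc 1 N, ((X n ω : ℝ) : ℂ) * circleNet (M N) j ^ n‖ ≤ 2 * (η * S N) := by
    refine Complex.norm_le_of_re_mul_le fun w hw => ?_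
    have hni : ω ∉ G N (w, j) := fun h =>
      hN (Set.mem_iUnion₂.2 ⟨(w, j), Finset.mem_product.2 ⟨hw, hj⟩, h⟩)
    simp only [hG, Set.mem_ofPred_eq, not_le] at hni
    refine le_trans (le_of_eq ?_) hni.le
    rw [Finset.mul_sum, Complex.re_sum]
    refine Finset.sum_congr rfl fun n _ => ?_
    rw [mul_left_comm, Complex.re_ofReal_mul, mul_comm]
  have hX1 : ∀ n, |X n ω| ≤ 1 := by
    intro n
    have h0 : 0 ≤ P.real (E n) := measureReal_nonneg
    have h1 : P.real (E n) ≤ 1 := measureReal_le_one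
    by_cases h : ω ∈ E n <;> simp only [hX, h, Set.indicator_of_mem, Set.indicator_of_notMem,
      not_false_eq_true] <;> rw [abs_le] <;> constructor <;> linarith
  have hdiff : ‖∑ n ∈ Finset.Icc 1 N, ((X n ω : ℝ) : ℂ) * (z ^ n - circleNet (M N) j ^ n)‖ ≤ η := by
    have : ∀ n ∈ Finset.Icc 1 N,
        ‖((X n ω : ℝ) : ℂ) * (z ^ n - circleNet (M N) j ^ n)‖ ≤ N * (7 / (M N : ℝ)) := by
      intro n hn
      rw [norm_mul, Complex.norm_real, Real.norm_eq_abs]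
      have hnN : (n : ℝ) ≤ N := by exact_mod_cast (Finset.mem_Icc.1 hn).2
      calc |X n ω| * _ ≤ 1 * (n * (7 / (M N : ℝ))) :=
            mul_le_mul (hX1 n) (hjn n) (norm_nonneg _) zero_le_one
        _ ≤ N * (7 / (M N : ℝ)) := by rw [one_mul]; gcongr
    refine (norm_sum_le_of_le _ this).trans ?_
    rw [Finset.sum_const, Nat.card_Icc, nsmul_eq_mul]
    simp only [hM]
    push_cast
    have e : (N : ℝ) * (N * (7 / (K * (N : ℝ) ^ 2))) = 7 / K := by field_simp
    rw [e, div_le_iff₀ hKR, mul_comm]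
    exact (div_le_iff₀ hη0).1 hK
  have hsplit : ∑ n ∈ Finset.Icc 1 N, ((X n ω : ℝ) : ℂ) * z ^ n
      = ∑ n ∈ Finset.Icc 1 N, ((X n ω : ℝ) : ℂ) * circleNet (M N) j ^ n
        + ∑ n ∈ Finset.Icc 1 N, ((X n ω : ℝ) : ℂ) * (z ^ n - circleNet (M N) j ^ n) := by
    rw [← Finset.sum_add_distrib]
    exact Finset.sum_congr rfl fun n _ => by ring
  change ‖∑ n ∈ Finset.Icc 1 N, ((X n ω : ℝ) : ℂ) * z ^ n‖ ≤ 3 * η * S N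
  rw [hsplit]
  refine (norm_add_le _ _).trans ?_
  nlinarith [hN1.2]

/-! ### Density zero from summability -/

/-- A set of integers over which `1 / (1 + |m|)` is summable has density zero. -/
theorem hasDensityZero_of_summable {B : Set ℤ}
    (hB : Summable (B.indicator fun m : ℤ => 1 / (1 + |(m : ℝ)|))) : HasDensityZero B := by
  classical
  have hpos : ∀ N : ℕ, (0 : ℝ) < 2 * N + 1 := fun N => by positivity
  have hrw : ∀ N : ℕ, ((B ∩ Set.Icc (-(N : ℤ)) (N : ℤ)).ncard : ℝ) / (2 * (N : ℝ) + 1)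
      = ∑' m : ℤ, (B ∩ Set.Icc (-(N : ℤ)) (N : ℤ)).indicator
          (fun _ => 1 / (2 * (N : ℝ) + 1)) m := by
    intro N
    have hfin : (B ∩ Set.Icc (-(N : ℤ)) (N : ℤ)).Finite := (Set.finite_Icc _ _).inter_of_right _
    rw [tsum_eq_sum (s := hfin.toFinset) (fun m hm => by
        rw [Set.indicator_of_notMem]; simpa using hm),
      Finset.sum_congr rfl (fun m hm => Set.indicator_of_mem (hfin.mem_toFinset.1 hm) _),
      Finset.sum_const, Set.ncard_eq_toFinset_card _ hfin, nsmul_eq_mul, mul_one_div]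
  have hlim : Tendsto (fun N : ℕ => 1 / (2 * (N : ℝ) + 1)) atTop (𝓝 0) := by
    refine tendsto_const_nhds.div_atTop (tendsto_atTop_add_const_right _ _ ?_)
    exact tendsto_natCast_atTop_atTop.const_mul_atTop two_pos
  rw [HasDensityZero, funext hrw]
  -- The density ratio is a sum over `B` of 1/(2N+1) restricted to |m| ≤ N; there 1/(2N+1) ≤
  -- 1/(1+|m|), a summable majorant independent of N.
  have := tendsto_tsum_of_dominated_convergence (𝓕 := atTop)
    (f := fun (N : ℕ) (m : ℤ) => (B ∩ Set.Icc (-(N : ℤ)) (N : ℤ)).indicator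
          (fun _ => 1 / (2 * (N : ℝ) + 1)) m) (g := fun _ => (0 : ℝ)) hB ?_ ?_
  · simpa using this
  · intro m
    refine squeeze_zero (fun N => Set.indicator_nonneg (fun _ _ => by positivity) _)
      (fun N => Set.indicator_le_self' (fun _ _ => by positivity) _) hlim
  · refine Eventually.of_forall fun N m => ?_
    by_cases hm : m ∈ B ∩ Set.Icc (-(N : ℤ)) (N : ℤ)
    · rw [Set.indicator_of_mem hm, Set.indicator_of_mem hm.1, Real.norm_of_nonneg (by positivity)]
      have : |(m : ℝ)| ≤ N := abs_le.2 ⟨by exact_mod_cast hm.2.1, by exact_mod_cast hm.2.2⟩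
      have hN : (0 : ℝ) ≤ N := N.cast_nonneg
      exact one_div_le_one_div_of_le (by positivity) (by linarith)
    · rw [Set.indicator_of_notMem hm, norm_zero]
      exact Set.indicator_nonneg (fun _ _ => by positivity) _

/-- A density-zero set and a finite exceptional set together have o(N) points in [-N, N], so they
cannot cover it. -/
theorem not_isAsymptoticBasis_of_hasDensityZero {D : Set ℤ}
    (hD : ∀ r : ℕ, 1 ≤ r → HasDensityZero (signedSums D r)) : ¬ IsAsymptoticBasis D := by
  rintro ⟨r, hr, hfin⟩
  set B := signedSums D r
  set K : ℕ := {m : ℤ | m ∉ B}.ncard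
  have hlim : Tendsto (fun N : ℕ => (K : ℝ) / (2 * (N : ℝ) + 1)) atTop (𝓝 0) := by
    refine tendsto_const_nhds.div_atTop (tendsto_atTop_add_const_right _ _ ?_)
    exact tendsto_natCast_atTop_atTop.const_mul_atTop two_pos
  have h := (hD r hr).add hlim
  rw [add_zero] at h
  refine absurd (ge_of_tendsto' h (b := 1) fun N => ?_) (by norm_num)
  rw [← add_div, le_div_iff₀ (by positivity), one_mul]
  have hcard : (Set.Icc (-(N : ℤ)) (N : ℤ)).ncard = 2 * N + 1 := by
    rw [← Finset.coe_Icc, Set.ncard_coe_finset, Int.card_Icc]; omega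
  have hsub : Set.Icc (-(N : ℤ)) (N : ℤ) ⊆
      (B ∩ Set.Icc (-(N : ℤ)) (N : ℤ)) ∪ {m : ℤ | m ∉ B} := by
    intro m hm
    by_cases h : m ∈ B
    · exact Or.inl ⟨h, hm⟩
    · exact Or.inr h
  have hle := (Set.ncard_le_ncard hsub
    (((Set.finite_Icc _ _).inter_of_right _).union hfin)).trans (Set.ncard_union_le _ _)
  rw [hcard] at hle
  exact_mod_cast hle

/-! ### Representations of signed sums and their expected weight -/

/-- Integer combinations of the elements of `S` with coefficients of size at most `r`. -/
noncomputable def boundedCombinations (r : ℕ) (S : Finset ℕ) : Finset ℤ :=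
  (S.pi fun _ => Finset.Icc (-(r : ℤ)) r).image fun c => ∑ n ∈ S.attach, c n n.2 * (n : ℕ)

theorem card_boundedCombinations_le (r : ℕ) (S : Finset ℕ) :
    (boundedCombinations r S).card ≤ (2 * r + 1) ^ S.card := by
  refine Finset.card_image_le.trans (le_of_eq ?_)
  rw [Finset.card_pi, Finset.prod_const, Int.card_Icc]
  congr 1; omega

theorem sum_mem_boundedCombinations {r : ℕ} {S : Finset ℕ} {c : ℕ → ℤ}
    (hc : ∀ n ∈ S, |c n| ≤ r) : ∑ n ∈ S, c n * n ∈ boundedCombinations r S := by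
  refine Finset.mem_image.2 ⟨fun n _ => c n, Finset.mem_pi.2 fun n hn => ?_, ?_⟩
  · exact Finset.mem_Icc.2 (abs_le.1 (hc n hn))
  · exact Finset.sum_attach S fun n => c n * (n : ℤ)

/-- Data `(S, a, c, M)` encoding an integer `a + c * M`, where `a` is a combination of the elements
of a set `S` of fewer than `r` integers below `M`. -/
def IsRepresentation (r : ℕ) (i : Finset ℕ × ℤ × ℤ × ℕ) : Prop :=
  i.2.1 ∈ boundedCombinations r i.1 ∧ i.2.2.1 ∈ Finset.Icc (-(r : ℤ)) r ∧ i.2.2.1 ≠ 0 ∧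
    i.1.card < r ∧ ∀ n ∈ i.1, n < i.2.2.2

/-- Grouping equal terms leaves distinct integers with coefficients of size at most `r`; the largest
one with nonzero coefficient is split off as `M`. -/
theorem exists_isRepresentation_of_mem_signedSums {A : Set ℕ} {r : ℕ} {m : ℤ}
    (hm : m ∈ signedSums ((fun n : ℕ => (n : ℤ)) '' A) r) (hm0 : m ≠ 0) :
    ∃ i : Finset ℕ × ℤ × ℤ × ℕ, IsRepresentation r i ∧
      (∀ n ∈ insert i.2.2.2 i.1, n ∈ A) ∧ i.2.1 + i.2.2.1 * i.2.2.2 = m := by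
  classical
  obtain ⟨s, d, hs, hd, rfl⟩ := hm
  choose k hkA hk using hd
  set c : ℕ → ℤ := fun n => ∑ i with k i = n, s i with hc
  have hcr : ∀ n, |c n| ≤ r := by
    intro n
    calc |c n| ≤ ∑ i with k i = n, |s i| := Finset.abs_sum_le_sum_abs _ _
      _ ≤ ∑ i : Fin r, 1 := by
        refine (Finset.sum_le_sum_of_subset_of_nonneg (Finset.filter_subset _ _)
          fun _ _ _ => abs_nonneg _).trans (Finset.sum_le_sum fun i _ => ?_)
        rcases hs i with h | h <;> simp [h]
      _ = r := by simp
  set I : Finset ℕ := Finset.univ.image k with hI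
  have hsum : ∑ i, s i * d i = ∑ n ∈ I, c n * n := by
    rw [← Finset.sum_fiberwise_of_maps_to (g := k) (t := I)
      (fun i _ => Finset.mem_image_of_mem _ (Finset.mem_univ i))]
    refine Finset.sum_congr rfl fun n _ => ?_
    rw [hc, Finset.sum_mul]
    refine Finset.sum_congr rfl fun i hi => ?_
    rw [← (Finset.mem_filter.1 hi).2, ← hk i]
  -- Terms may cancel completely; dropping them makes the coefficient of the maximum nonzero, and `m
  -- ≠ 0` ensures that some term survives.
  set T : Finset ℕ := I.filter fun n => c n ≠ 0 with hT
  have hsumT : ∑ i, s i * d i = ∑ n ∈ T, c n * n := by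
    rw [hsum, hT, Finset.sum_filter]
    refine Finset.sum_congr rfl fun n _ => ?_
    by_cases h : c n = 0 <;> simp [h]
  have hTne : T.Nonempty := by
    rw [Finset.nonempty_iff_ne_empty]
    intro h
    rw [hsumT, h] at hm0
    simp at hm0
  have hTA : ∀ n ∈ T, n ∈ A := by
    intro n hn
    obtain ⟨i, -, rfl⟩ := Finset.mem_image.1 (Finset.mem_filter.1 hn).1
    exact hkA i
  have hTcard : T.card ≤ r := by
    refine (Finset.card_le_card (Finset.filter_subset _ _)).trans (Finset.card_image_le.trans ?_)
    simp
  set M := T.max' hTne with hM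
  have hMT : M ∈ T := T.max'_mem hTne
  refine ⟨(T.erase M, ∑ n ∈ T.erase M, c n * n, c M, M),
    ⟨sum_mem_boundedCombinations fun n _ => hcr n, Finset.mem_Icc.2 (abs_le.1 (hcr M)),
      (Finset.mem_filter.1 hMT).2, ?_, fun n hn => ?_⟩, ?_, ?_⟩
  · have := Finset.card_erase_lt_of_mem hMT
    exact this.trans_le hTcard
  · exact lt_of_le_of_ne (T.le_max' n (Finset.mem_of_mem_erase hn)) (Finset.ne_of_mem_erase hn)
  · intro n hn
    rw [Finset.insert_erase hMT] at hn
    exact hTA n hn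
  · rw [hsumT]
    exact Finset.sum_erase_add _ _ hMT

/-- The weight of a representation in the estimate of the expected number of represented
integers. -/
theorem prod_mul_le_of_isRepresentation {q : ℕ → ℝ} {r : ℕ} {C : ℝ} (hq0 : ∀ n, 0 ≤ q n)
    (hC : 0 ≤ C) (hr : 1 ≤ r)
    (hq : ∀ n : ℕ, q n ≤ C * ((n : ℝ) + 1) ^ (-(1 - 1 / (16 * r) : ℝ)))
    {i : Finset ℕ × ℤ × ℤ × ℕ} (hi : IsRepresentation r i) :
    (∏ n ∈ insert i.2.2.2 i.1, q n) * (1 / (1 + |((i.2.1 + i.2.2.1 * i.2.2.2 : ℤ) : ℝ)|)) ≤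
      (∏ n ∈ i.1, C * ((n : ℝ) + 1) ^ (-(1 + 1 / (16 * r) : ℝ))) *
        (C * (((i.2.2.2 : ℝ) + 1) ^ (-(3 / 2) : ℝ) +
          1 / (1 + |((i.2.1 + i.2.2.1 * i.2.2.2 : ℤ) : ℝ)|) ^ 2)) := by
  obtain ⟨S, a, c, M⟩ := i
  obtain ⟨-, -, -, hcard, hlt⟩ := hi
  simp only at hcard hlt ⊢
  have hr' : (1 : ℝ) ≤ r := by exact_mod_cast hr
  have hr16 : 1 / (16 * r : ℝ) ≤ 1 / 16 := one_div_le_one_div_of_le (by norm_num) (by linarith)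
  have hr0 : 0 < 1 / (16 * r : ℝ) := by positivity
  set e : ℝ := 1 / (16 * r) with he
  set y : ℝ := 1 / (1 + |((a + c * M : ℤ) : ℝ)|) with hy
  have hy0 : 0 ≤ y := by positivity
  have hM1 : (1 : ℝ) ≤ (M : ℝ) + 1 := by linarith [M.cast_nonneg (α := ℝ)]
  have hM0 : (0 : ℝ) < (M : ℝ) + 1 := by linarith
  rw [Finset.prod_insert (fun h => lt_irrefl _ (hlt M h))]
  -- Since 1 - 1/16 ≥ 3/4 + 1/8, a factor (M+1)^(-1/8) can be spared. It is shared among the fewer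
  -- than `r` elements n < M, each receiving (n+1)^(-2e) because 2er = 1/8; this lifts their
  -- exponent from 1 - e to the summable 1 + e.
  have hqM : q M ≤ C * (((M : ℝ) + 1) ^ (-(3 / 4) : ℝ) * ((M : ℝ) + 1) ^ (-(1 / 8) : ℝ)) := by
    refine (hq M).trans (mul_le_mul_of_nonneg_left ?_ hC)
    rw [← Real.rpow_add hM0]
    exact Real.rpow_le_rpow_of_exponent_le hM1 (by linarith)
  have hsmall : ((M : ℝ) + 1) ^ (-(1 / 8) : ℝ) ≤ ∏ n ∈ S, ((n : ℝ) + 1) ^ (-(2 * e)) := by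
    have h1 : ((M : ℝ) + 1) ^ (-(1 / 8) : ℝ) ≤ (((M : ℝ) + 1) ^ (-(2 * e))) ^ S.card := by
      rw [← Real.rpow_natCast, ← Real.rpow_mul hM0.le]
      refine Real.rpow_le_rpow_of_exponent_le hM1 ?_
      have : (S.card : ℝ) ≤ r := by exact_mod_cast hcard.le
      have h2 : 2 * e * S.card ≤ 2 * e * r := by gcongr
      have h3 : 2 * e * r = 1 / 8 := by rw [he]; field_simp; norm_num
      linarith
    refine h1.trans ?_
    rw [← Finset.prod_const]
    refine Finset.prod_le_prod (fun _ _ => by positivity) fun n hn => ?_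
    refine Real.rpow_le_rpow_of_nonpos (by positivity) ?_ (by linarith)
    have : (n : ℝ) ≤ M := by exact_mod_cast (hlt n hn).le
    linarith
  have hS : (∏ n ∈ S, q n) * ∏ n ∈ S, ((n : ℝ) + 1) ^ (-(2 * e))
      ≤ ∏ n ∈ S, C * ((n : ℝ) + 1) ^ (-(1 + e)) := by
    rw [← Finset.prod_mul_distrib]
    refine Finset.prod_le_prod (fun n _ => mul_nonneg (hq0 n) (by positivity)) fun n _ => ?_
    refine (mul_le_mul_of_nonneg_right (hq n) (by positivity)).trans (le_of_eq ?_)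
    rw [mul_assoc, ← Real.rpow_add (by positivity)]
    congr 2; ring
  -- This separates the decay in M from the decay in the represented integer, leaving two terms each
  -- summable in M.
  have hyoung : ((M : ℝ) + 1) ^ (-(3 / 4) : ℝ) * y ≤ ((M : ℝ) + 1) ^ (-(3 / 2) : ℝ) + y ^ 2 := by
    have : ((M : ℝ) + 1) ^ (-(3 / 2) : ℝ) = (((M : ℝ) + 1) ^ (-(3 / 4) : ℝ)) ^ 2 := by
      rw [← Real.rpow_natCast, ← Real.rpow_mul hM0.le]; norm_num
    rw [this]
    nlinarith [sq_nonneg (((M : ℝ) + 1) ^ (-(3 / 4) : ℝ) - y),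
      sq_nonneg (((M : ℝ) + 1) ^ (-(3 / 4) : ℝ)), sq_nonneg y]
  have hP0 : 0 ≤ ∏ n ∈ S, q n := Finset.prod_nonneg fun n _ => hq0 n
  have hy2 : 1 / (1 + |((a + c * M : ℤ) : ℝ)|) ^ 2 = y ^ 2 := by rw [hy, div_pow, one_pow]
  rw [hy2]
  calc q M * (∏ n ∈ S, q n) * y
      ≤ C * (((M : ℝ) + 1) ^ (-(3 / 4) : ℝ) * ((M : ℝ) + 1) ^ (-(1 / 8) : ℝ))
          * (∏ n ∈ S, q n) * y := by gcongr
    _ ≤ C * (((M : ℝ) + 1) ^ (-(3 / 4) : ℝ) * ∏ n ∈ S, ((n : ℝ) + 1) ^ (-(2 * e)))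
          * (∏ n ∈ S, q n) * y := by gcongr
    _ = ((∏ n ∈ S, q n) * ∏ n ∈ S, ((n : ℝ) + 1) ^ (-(2 * e)))
          * (C * (((M : ℝ) + 1) ^ (-(3 / 4) : ℝ) * y)) := by ring
    _ ≤ (∏ n ∈ S, C * ((n : ℝ) + 1) ^ (-(1 + e)))
          * (C * (((M : ℝ) + 1) ^ (-(3 / 2) : ℝ) + y ^ 2)) := by gcongr

/-- For c ≠ 0 the map M ↦ a + cM is injective, so the second part is dominated by the sum over all
integers, uniformly in `a` and `c`. -/
theorem tsum_ofReal_affine_le (a c : ℤ) (hc : c ≠ 0) :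
    ∑' M : ℕ, ENNReal.ofReal (((M : ℝ) + 1) ^ (-(3 / 2) : ℝ) +
        1 / (1 + |((a + c * M : ℤ) : ℝ)|) ^ 2) ≤
      ∑' M : ℕ, ENNReal.ofReal (((M : ℝ) + 1) ^ (-(3 / 2) : ℝ)) +
        ∑' m : ℤ, ENNReal.ofReal (1 / (1 + |(m : ℝ)|) ^ 2) := by
  have : ∀ M : ℕ, ENNReal.ofReal (((M : ℝ) + 1) ^ (-(3 / 2) : ℝ) +
        1 / (1 + |((a + c * M : ℤ) : ℝ)|) ^ 2) = ENNReal.ofReal (((M : ℝ) + 1) ^ (-(3 / 2) : ℝ)) +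
        ENNReal.ofReal (1 / (1 + |((a + c * M : ℤ) : ℝ)|) ^ 2) := fun M =>
    ENNReal.ofReal_add (by positivity) (by positivity)
  rw [tsum_congr this, ENNReal.tsum_add]
  gcongr
  have hinj : Function.Injective fun M : ℕ => a + c * (M : ℤ) := fun M M' h => by
    simpa [hc] using h
  exact ENNReal.tsum_comp_le_tsum_of_injective hinj
    (fun m : ℤ => ENNReal.ofReal (1 / (1 + |(m : ℝ)|) ^ 2))

theorem summable_add_one_rpow_neg {s : ℝ} (hs : 1 < s) :
    Summable fun n : ℕ => ((n : ℝ) + 1) ^ (-s) := by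
  have := (summable_nat_add_iff 1).2 (Real.summable_nat_rpow.2 (neg_lt_neg hs))
  simpa using this

theorem summable_one_div_one_add_abs_sq : Summable fun m : ℤ => 1 / (1 + |(m : ℝ)|) ^ 2 := by
  have h : Summable fun n : ℕ => 1 / ((n : ℝ) + 1) ^ 2 := by
    have := (summable_nat_add_iff 1).2 (Real.summable_one_div_nat_pow.2 (one_lt_two))
    simpa using this
  refine Summable.of_nat_of_neg ?_ ?_ <;> simpa [add_comm] using h

/-- The expected number of representations, weighted by the size of the represented integer, is
finite. -/
theorem tsum_isRepresentation_ne_top {q : ℕ → ℝ} {r : ℕ} {C : ℝ} (hq0 : ∀ n, 0 ≤ q n)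
    (hC : 0 ≤ C) (hr : 1 ≤ r)
    (hq : ∀ n : ℕ, q n ≤ C * ((n : ℝ) + 1) ^ (-(1 - 1 / (16 * r) : ℝ))) :
    ∑' i : Finset ℕ × ℤ × ℤ × ℕ, {i | IsRepresentation r i}.indicator (fun i =>
      ENNReal.ofReal ((∏ n ∈ insert i.2.2.2 i.1, q n) *
        (1 / (1 + |((i.2.1 + i.2.2.1 * i.2.2.2 : ℤ) : ℝ)|)))) i ≠ ⊤ := by
  classical
  have hr0 : 0 < 1 / (16 * r : ℝ) := by
    have : (1 : ℝ) ≤ r := by exact_mod_cast hr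
    positivity
  set D : ENNReal := ∑' M : ℕ, ENNReal.ofReal (((M : ℝ) + 1) ^ (-(3 / 2) : ℝ)) +
        ∑' m : ℤ, ENNReal.ofReal (1 / (1 + |(m : ℝ)|) ^ 2) with hD
  have hDtop : D ≠ ⊤ := ENNReal.add_ne_top.2
    ⟨(summable_add_one_rpow_neg (by norm_num)).tsum_ofReal_ne_top,
      summable_one_div_one_add_abs_sq.tsum_ofReal_ne_top⟩
  set f : ℕ → ℝ := fun n => C * ((n : ℝ) + 1) ^ (-(1 + 1 / (16 * r) : ℝ)) with hf
  have hf0 : ∀ n, 0 ≤ f n := fun n => by positivity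
  -- The sum over all finite sets is the expansion of ∏ (1 + (2r+1) f(n)). The factor 2r+1 per
  -- element pays for the at most (2r+1)^|S| values of `a`.
  have hfsum : Summable fun S : Finset ℕ => ∏ n ∈ S, ((2 * r + 1 : ℕ) : ℝ) * f n := by
    refine summable_finsetProd_of_summable_nonneg
      (fun n => mul_nonneg (Nat.cast_nonneg _) (hf0 n)) ?_
    exact ((summable_add_one_rpow_neg (by linarith)).mul_left C).mul_left _
  set J : Finset ℤ := Finset.Icc (-(r : ℤ)) r with hJ
  have hJcard : J.card = 2 * r + 1 := by rw [hJ, Int.card_Icc]; omega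
  -- The constraints |S| < r and n < M have served in the pointwise bound; dropping them here lets
  -- the sums over S, a, c and M be bounded one after another.
  set G : Finset ℕ → ℤ → ℤ → ℕ → ENNReal := fun S a c M =>
    if a ∈ boundedCombinations r S then if c ∈ J then if c ≠ 0 then
      ENNReal.ofReal (∏ n ∈ S, f n) * (ENNReal.ofReal C *
        ENNReal.ofReal (((M : ℝ) + 1) ^ (-(3 / 2) : ℝ) +
          1 / (1 + |((a + c * M : ℤ) : ℝ)|) ^ 2)) else 0 else 0 else 0 with hG
  have hle : ∀ i : Finset ℕ × ℤ × ℤ × ℕ, {i | IsRepresentation r i}.indicator (fun i =>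
      ENNReal.ofReal ((∏ n ∈ insert i.2.2.2 i.1, q n) *
        (1 / (1 + |((i.2.1 + i.2.2.1 * i.2.2.2 : ℤ) : ℝ)|)))) i
      ≤ G i.1 i.2.1 i.2.2.1 i.2.2.2 := by
    intro i
    refine Set.indicator_apply_le' (fun hi => ?_) fun _ => zero_le
    have hi' : IsRepresentation r i := hi
    simp only [hG]
    rw [if_pos hi'.1, if_pos hi'.2.1, if_pos hi'.2.2.1,
      ← ENNReal.ofReal_mul hC, ← ENNReal.ofReal_mul (Finset.prod_nonneg fun n _ => hf0 n)]
    exact ENNReal.ofReal_le_ofReal (prod_mul_le_of_isRepresentation hq0 hC hr hq hi')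
  have hM : ∀ S a c, ∑' M, G S a c M ≤ if a ∈ boundedCombinations r S then if c ∈ J then
      ENNReal.ofReal (∏ n ∈ S, f n) * (ENNReal.ofReal C * D) else 0 else 0 := by
    intro S a c
    simp only [hG]
    split_ifs with h1 h2 h3
    · rw [ENNReal.tsum_mul_left, ENNReal.tsum_mul_left]
      gcongr
      exact tsum_ofReal_affine_le a c h3
    all_goals simp
  have hS : ∀ S, ∑' a, ∑' c, ∑' M, G S a c M ≤
      ENNReal.ofReal (∏ n ∈ S, ((2 * r + 1 : ℕ) : ℝ) * f n) *
        (((2 * r + 1 : ℕ) : ENNReal) * (ENNReal.ofReal C * D)) := by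
    intro S
    calc ∑' a, ∑' c, ∑' M, G S a c M
        ≤ ∑' a, ∑' c, if a ∈ boundedCombinations r S then if c ∈ J then
          ENNReal.ofReal (∏ n ∈ S, f n) * (ENNReal.ofReal C * D) else 0 else 0 :=
          ENNReal.tsum_le_tsum fun a => ENNReal.tsum_le_tsum fun c => hM S a c
      _ = ∑' a, if a ∈ boundedCombinations r S then ((2 * r + 1 : ℕ) : ENNReal) *
          (ENNReal.ofReal (∏ n ∈ S, f n) * (ENNReal.ofReal C * D)) else 0 := by
          refine tsum_congr fun a => ?_
          split_ifs
          · rw [tsum_eq_sum (s := J) (fun c hc => if_neg hc), Finset.sum_congr rfl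
              (fun c hc => if_pos hc), Finset.sum_const, hJcard, nsmul_eq_mul]
          · simp
      _ = (boundedCombinations r S).card * (((2 * r + 1 : ℕ) : ENNReal) *
          (ENNReal.ofReal (∏ n ∈ S, f n) * (ENNReal.ofReal C * D))) := by
          rw [tsum_eq_sum (s := boundedCombinations r S) (fun c hc => if_neg hc),
            Finset.sum_congr rfl (fun c hc => if_pos hc), Finset.sum_const, nsmul_eq_mul]
      _ ≤ (((2 * r + 1) ^ S.card : ℕ) : ENNReal) * (((2 * r + 1 : ℕ) : ENNReal) *
          (ENNReal.ofReal (∏ n ∈ S, f n) * (ENNReal.ofReal C * D))) := by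
          gcongr
          exact card_boundedCombinations_le r S
      _ = _ := by
          have : ∏ n ∈ S, ((2 * r + 1 : ℕ) : ℝ) * f n
              = (((2 * r + 1) ^ S.card : ℕ) : ℝ) * ∏ n ∈ S, f n := by
            rw [Finset.prod_mul_distrib, Finset.prod_const, Nat.cast_pow]
          rw [this, ENNReal.ofReal_mul (Nat.cast_nonneg _), ENNReal.ofReal_natCast]
          ring
  refine ne_top_of_le_ne_top ?_ (ENNReal.tsum_le_tsum hle)
  rw [ENNReal.tsum_prod']
  simp_rw [ENNReal.tsum_prod']
  refine ne_top_of_le_ne_top ?_ (ENNReal.tsum_le_tsum hS)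
  rw [ENNReal.tsum_mul_right]
  exact ENNReal.mul_ne_top hfsum.tsum_ofReal_ne_top (ENNReal.mul_ne_top (ENNReal.natCast_ne_top _)
    (ENNReal.mul_ne_top ENNReal.ofReal_ne_top hDtop))

/-- Signed sums of a sparse random set almost surely have density zero. -/
theorem ProbabilityTheory.iIndepSet.ae_hasDensityZero_signedSums {Ω : Type*}
    [MeasurableSpace Ω] {P : Measure Ω} [IsProbabilityMeasure P] {E : ℕ → Set Ω}
    (hE : ∀ n, MeasurableSet (E n)) (hind : iIndepSet E P) {r : ℕ} {C : ℝ}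
    (hC : 0 ≤ C) (hr : 1 ≤ r)
    (hq : ∀ n : ℕ, P.real (E n) ≤ C * ((n : ℝ) + 1) ^ (-(1 - 1 / (16 * r) : ℝ))) :
    ∀ᵐ ω ∂P, HasDensityZero (signedSums ((fun n : ℕ => (n : ℤ)) '' {n | ω ∈ E n}) r) := by
  classical
  set w : ℤ → ENNReal := fun m => ENNReal.ofReal (1 / (1 + |(m : ℝ)|)) with hw
  set Z : Finset ℕ × ℤ × ℤ × ℕ → Ω → ENNReal := fun i =>
    if IsRepresentation r i then (⋂ n ∈ insert i.2.2.2 i.1, E n).indicator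
      (fun _ => w (i.2.1 + i.2.2.1 * i.2.2.2)) else 0 with hZ
  have hmeasI : ∀ S : Finset ℕ, MeasurableSet (⋂ n ∈ S, E n) := fun S =>
    S.measurableSet_biInter fun n _ => hE n
  have hZm : ∀ i, Measurable (Z i) := by
    intro i
    simp only [hZ]
    split_ifs
    · exact measurable_const.indicator (hmeasI _)
    · exact measurable_const
  -- Tonelli and independence reduce the expected total weight to the deterministic series of
  -- `tsum_isRepresentation_ne_top`.
  have hint : ∫⁻ ω, ∑' i, Z i ω ∂P ≠ ⊤ := by
    rw [lintegral_tsum fun i => (hZm i).aemeasurable]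
    convert tsum_isRepresentation_ne_top (q := fun n => P.real (E n))
      (fun n => measureReal_nonneg) hC hr hq using 3 with i
    by_cases hi : IsRepresentation r i
    · rw [Set.indicator_of_mem (show i ∈ {i | IsRepresentation r i} from hi)]
      simp only [hZ, if_pos hi]
      rw [lintegral_indicator_const (hmeasI _), hind.meas_biInter,
        ENNReal.ofReal_mul (Finset.prod_nonneg fun n _ => measureReal_nonneg),
        ENNReal.ofReal_prod_of_nonneg (fun n _ => measureReal_nonneg), mul_comm]
      simp [hw, measureReal_def]
    · rw [Set.indicator_of_notMem (show i ∉ {i | IsRepresentation r i} from hi)]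
      simp [hZ, hi]
  filter_upwards [ae_lt_top (Measurable.tsum hZm) hint] with ω hω
  set A : Set ℕ := {n | ω ∈ E n} with hA
  set B := signedSums ((fun n : ℕ => (n : ℤ)) '' A) r with hB
  have hrep : ∀ m : {m : ℤ // m ∈ B ∧ m ≠ 0}, ∃ i : Finset ℕ × ℤ × ℤ × ℕ, IsRepresentation r i ∧
      (∀ n ∈ insert i.2.2.2 i.1, n ∈ A) ∧ i.2.1 + i.2.2.1 * i.2.2.2 = m := fun m =>
    exists_isRepresentation_of_mem_signedSums m.2.1 m.2.2
  choose ρ hρ1 hρ2 hρ3 using hrep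
  -- The data determine the integer they represent, so one representation per `m` embeds the weights
  -- over `B \ {0}` into the almost surely finite sum of the `Z i ω`.
  have hρinj : Function.Injective ρ := fun m m' h => by
    apply Subtype.ext
    rw [← hρ3 m, ← hρ3 m', h]
  have hsub : ∑' m : {m : ℤ // m ∈ B ∧ m ≠ 0}, w m ≠ ⊤ := by
    refine ne_top_of_le_ne_top hω.ne (le_trans (le_of_eq ?_)
      (ENNReal.tsum_comp_le_tsum_of_injective hρinj fun i => Z i ω))
    refine tsum_congr fun m => ?_
    simp only [hZ, if_pos (hρ1 m)]
    rw [Set.indicator_of_mem (Set.mem_iInter₂.2 fun n hn => hρ2 m n hn), hρ3]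
  have hsummable : Summable fun m : {m : ℤ // m ∈ B ∧ m ≠ 0} => 1 / (1 + |((m : ℤ) : ℝ)|) := by
    have := ENNReal.summable_toReal hsub
    refine this.congr fun m => ?_
    rw [hw, ENNReal.toReal_ofReal (by positivity)]
  refine hasDensityZero_of_summable ?_
  have h1 : Summable ({m : ℤ | m ∈ B ∧ m ≠ 0}.indicator fun m : ℤ => 1 / (1 + |(m : ℝ)|)) :=
    summable_subtype_iff_indicator.1 hsummable
  refine h1.congr_cofinite ?_
  filter_upwards [(Set.finite_singleton (0 : ℤ)).compl_mem_cofinite] with m hm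
  have hm0 : m ≠ 0 := hm
  by_cases h : m ∈ B
  · rw [Set.indicator_of_mem (show m ∈ {m : ℤ | m ∈ B ∧ m ≠ 0} from ⟨h, hm0⟩),
      Set.indicator_of_mem h]
  · rw [Set.indicator_of_notMem (fun h' => h h'.1), Set.indicator_of_notMem h]

/-! ### Almost sure properties of the random set -/

/-- At z = 1 the number of elements up to N is at least half of the divergent sum of `q`. -/
theorem infinite_of_uniform_average {A : Set ℕ} {a q : ℕ → ℝ}
    (ha : ∀ n, a n = A.indicator 1 n)
    (hP : Tendsto (fun N : ℕ => ∑ n ∈ Finset.Icc 1 N, q n) atTop atTop)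
    (hunif : ∀ η : ℝ, 0 < η → ∀ᶠ N : ℕ in atTop, ∀ z : ℂ, ‖z‖ = 1 →
      ‖∑ n ∈ Finset.Icc 1 N, ((a n - q n : ℝ) : ℂ) * z ^ n‖ ≤ η * ∑ n ∈ Finset.Icc 1 N, q n) :
    A.Infinite := by
  intro hfin
  obtain ⟨N, h1, h2⟩ := ((hunif (1 / 2) (by norm_num)).and
    (hP.eventually_gt_atTop (2 * hfin.toFinset.card))).exists
  have h3 := h1 1 (by simp)
  simp only [one_pow, mul_one] at h3
  rw [← Complex.ofReal_sum, Complex.norm_real, Finset.sum_sub_distrib, Real.norm_eq_abs] at h3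
  have h4 : ∑ n ∈ Finset.Icc 1 N, a n ≤ hfin.toFinset.card := by
    classical
    simp only [ha, Set.indicator_apply, Pi.one_apply]
    rw [Finset.sum_boole]
    exact_mod_cast Finset.card_le_card fun n hn => by simpa using (Finset.mem_filter.1 hn).2
  linarith [(abs_le.1 h3).1]

/-- Independent events with slowly varying probabilities, neither too small nor too large, yield a
random set which is almost surely Kazhdan and has sparse signed sums. -/
theorem ProbabilityTheory.iIndepSet.ae_isKazhdanSet_and_hasDensityZero {Ω : Type*}
    [MeasurableSpace Ω] {P : Measure Ω} [IsProbabilityMeasure P] {E : ℕ → Set Ω}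
    (hE : ∀ n, MeasurableSet (E n)) (hind : iIndepSet E P)
    (hlog : Tendsto (fun N : ℕ => (1 / Real.log (N : ℝ)) * ∑ n ∈ Finset.Icc 1 N, P.real (E n))
      atTop atTop)
    (hvar : (fun N : ℕ => ∑ n ∈ Finset.Icc 1 N, |P.real (E (n + 1)) - P.real (E n)|) =o[atTop]
      (fun N : ℕ => ∑ n ∈ Finset.Icc 1 N, P.real (E n)))
    (hdecay : ∀ ε : ℝ, 0 < ε → ε < 1 → ∃ C : ℝ, 0 ≤ C ∧
      ∀ n : ℕ, P.real (E n) ≤ C * ((n : ℝ) + 1) ^ (-(1 - ε))) :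
    ∀ᵐ ω ∂P, {n | ω ∈ E n}.Infinite ∧ IsKazhdanSet ((fun n : ℕ => (n : ℤ)) '' {n | ω ∈ E n}) ∧
      ∀ r : ℕ, 1 ≤ r →
        HasDensityZero (signedSums ((fun n : ℕ => (n : ℤ)) '' {n | ω ∈ E n}) r) := by
  have hP : Tendsto (fun N : ℕ => ∑ n ∈ Finset.Icc 1 N, P.real (E n)) atTop atTop := by
    refine tendsto_atTop_mono' _ ?_ hlog
    filter_upwards [eventually_ge_atTop 3] with N hN
    have h3 : (3 : ℝ) ≤ N := by exact_mod_cast hN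
    have hl : 1 ≤ Real.log N := by
      rw [Real.le_log_iff_exp_le (by linarith)]
      linarith [Real.exp_one_lt_d9]
    refine mul_le_of_le_one_left (Finset.sum_nonneg fun _ _ => measureReal_nonneg) ?_
    rw [one_div]
    exact inv_le_one_of_one_le₀ hl
  have hunif : ∀ᵐ ω ∂P, ∀ k : ℕ, ∀ᶠ N : ℕ in atTop, ∀ z : ℂ, ‖z‖ = 1 →
      ‖∑ n ∈ Finset.Icc 1 N,
        (((E n).indicator (fun _ => (1 : ℝ)) ω - P.real (E n) : ℝ) : ℂ) * z ^ n‖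
        ≤ 3 * (1 / ((k : ℝ) + 1)) * ∑ n ∈ Finset.Icc 1 N, P.real (E n) := by
    -- Countably many tolerances 1/(k+1) give a single null set valid for every η.
    refine ae_all_iff.2 fun k => ?_
    refine hind.ae_eventually_norm_sum_le hE hlog (by positivity) ?_
    rw [div_le_one (by positivity)]
    linarith [k.cast_nonneg (α := ℝ)]
  have hdens : ∀ᵐ ω ∂P, ∀ r : ℕ, 1 ≤ r →
      HasDensityZero (signedSums ((fun n : ℕ => (n : ℤ)) '' {n | ω ∈ E n}) r) := by
    refine ae_all_iff.2 fun r => ?_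
    by_cases hr : 1 ≤ r
    · have hr' : (1 : ℝ) ≤ r := by exact_mod_cast hr
      obtain ⟨C, hC, hCq⟩ := hdecay (1 / (16 * r)) (by positivity)
        (by rw [div_lt_one (by positivity)]; linarith)
      filter_upwards [hind.ae_hasDensityZero_signedSums hE hC hr hCq] with ω hω _ using hω
    · exact Eventually.of_forall fun ω h => absurd h hr
  filter_upwards [hunif, hdens] with ω hω hωd
  set A : Set ℕ := {n | ω ∈ E n} with hA
  have ha : ∀ n, (E n).indicator (fun _ => (1 : ℝ)) ω = A.indicator 1 n := fun n => by
    by_cases h : ω ∈ E n <;> simp [hA, h]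
  have hω' : ∀ η : ℝ, 0 < η → ∀ᶠ N : ℕ in atTop, ∀ z : ℂ, ‖z‖ = 1 →
      ‖∑ n ∈ Finset.Icc 1 N,
        (((E n).indicator (fun _ => (1 : ℝ)) ω - P.real (E n) : ℝ) : ℂ) * z ^ n‖
        ≤ η * ∑ n ∈ Finset.Icc 1 N, P.real (E n) := by
    intro η hη
    obtain ⟨k, hk⟩ := exists_nat_one_div_lt (show 0 < η / 3 by positivity)
    filter_upwards [hω k] with N hN z hz
    refine (hN z hz).trans ?_
    gcongr
    linarith
  exact ⟨infinite_of_uniform_average ha hP hω', isKazhdanSet_of_uniform_average ha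
    (fun n _ => ⟨measureReal_nonneg, measureReal_le_one⟩) hP hvar hω', hωd⟩

/-! ### From random variables to the random sequence -/

/-- Independence over the positive integers is independence over `ℕ` once an empty event is put
at `0`. -/
theorem ProbabilityTheory.iIndepFun.iIndepSet_pos_preimage {Ω : Type*} [MeasurableSpace Ω]
    {P : Measure Ω} {ξ : ℕ → Ω → ℝ} (hmeas : ∀ n : ℕ, 1 ≤ n → Measurable (ξ n))
    (hindep : iIndepFun (fun n : ℕ+ => ξ (n : ℕ)) P) :
    (∀ n, MeasurableSet {ω | 1 ≤ n ∧ ξ n ω = 1}) ∧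
      iIndepSet (fun n => {ω | 1 ≤ n ∧ ξ n ω = 1}) P := by
  have hm : ∀ n, MeasurableSet {ω | 1 ≤ n ∧ ξ n ω = 1} := by
    intro n
    by_cases h : 1 ≤ n
    · have : {ω | 1 ≤ n ∧ ξ n ω = 1} = ξ n ⁻¹' {1} := by ext ω; simp [h]
      rw [this]
      exact hmeas n h (measurableSet_singleton 1)
    · simp [h]
  refine ⟨hm, (iIndepSet_iff_meas_biInter hm).2 fun s => ?_⟩
  by_cases h0 : 0 ∈ s
  · rw [Finset.prod_eq_zero h0 (by simp)]
    exact measure_mono_null (Set.biInter_subset_of_mem h0) (by simp)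
  · set S : Finset ℕ+ := s.subtype (0 < ·) with hS
    have hmap : S.map (Function.Embedding.subtype (0 < ·)) = s :=
      Finset.subtype_map_of_mem fun n hn => Nat.pos_of_ne_zero fun h => h0 (h ▸ hn)
    have key := hindep.measure_inter_preimage_eq_mul S (sets := fun _ => {1})
      fun _ _ => measurableSet_singleton _
    have hpos : ∀ n : ℕ+, {ω | 1 ≤ (n : ℕ) ∧ ξ n ω = 1} = ξ n ⁻¹' {1} := fun n => by
      ext ω
      exact and_iff_right n.pos
    have hinter : ⋂ n ∈ s, {ω | 1 ≤ n ∧ ξ n ω = 1} = ⋂ n ∈ S, ξ (n : ℕ) ⁻¹' {1} := by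
      ext ω
      simp only [Set.mem_iInter]
      refine ⟨fun h n hn => ?_, fun h n hn => ?_⟩
      · rw [← hpos]
        exact h n (Finset.mem_subtype.1 hn)
      · have hn0 : 0 < n := Nat.pos_of_ne_zero fun h' => h0 (h' ▸ hn)
        exact ⟨hn0, h ⟨n, hn0⟩ (Finset.mem_subtype.2 hn)⟩
    have hprod : ∏ n ∈ s, P {ω | 1 ≤ n ∧ ξ n ω = 1} = ∏ n ∈ S, P (ξ (n : ℕ) ⁻¹' {1}) := by
      rw [← hmap, Finset.prod_map]
      exact Finset.prod_congr rfl fun n _ => congrArg P (hpos n)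
    rw [hinter, hprod, key]

/-- Shifting the base to n + 1 makes the bound meaningful at n = 0; it costs a factor 2, since n + 1
≤ 2n for n ≥ 1. -/
theorem exists_le_mul_add_one_rpow {p q : ℕ → ℝ} (hq0 : q 0 = 0) (hqp : ∀ n, 1 ≤ n → q n = p n)
    {ε : ℝ} (hε0 : 0 < ε) (hε1 : ε < 1)
    (h : p =O[atTop] (fun n : ℕ => 1 / (n : ℝ) ^ (1 - ε))) :
    ∃ C : ℝ, 0 ≤ C ∧ ∀ n : ℕ, q n ≤ C * ((n : ℝ) + 1) ^ (-(1 - ε)) := by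
  obtain ⟨C, hC, hb⟩ := bound_of_isBigO_nat_atTop h
  refine ⟨2 * C, by positivity, fun n => ?_⟩
  rcases Nat.eq_zero_or_pos n with rfl | hn
  · rw [hq0]; positivity
  have hn' : (1 : ℝ) ≤ n := by exact_mod_cast hn
  have h1 := hb (x := n) (by positivity)
  rw [Real.norm_of_nonneg (show 0 ≤ 1 / (n : ℝ) ^ (1 - ε) by positivity)] at h1
  rw [hqp n hn]
  refine (Real.le_norm_self _).trans (h1.trans ?_)
  rw [Real.rpow_neg (by positivity), ← one_div, mul_comm 2 C, mul_assoc]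
  refine mul_le_mul_of_nonneg_left ?_ hC.le
  rw [mul_one_div, div_le_div_iff₀ (by positivity) (by positivity), one_mul]
  calc ((n : ℝ) + 1) ^ (1 - ε) ≤ (2 * n) ^ (1 - ε) :=
        Real.rpow_le_rpow (by positivity) (by linarith) (by linarith)
    _ = 2 ^ (1 - ε) * (n : ℝ) ^ (1 - ε) := Real.mul_rpow (by norm_num) (by positivity)
    _ ≤ 2 ^ (1 : ℝ) * (n : ℝ) ^ (1 - ε) := by gcongr <;> linarith
    _ = 2 * (n : ℝ) ^ (1 - ε) := by rw [Real.rpow_one]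

theorem ae_randomSeq {p : ℕ → ℝ}
    (h1 : Tendsto (fun N : ℕ => (1 / Real.log (N : ℝ)) * ∑ n ∈ Finset.Icc 1 N, p n) atTop atTop)
    (h2 : (fun N : ℕ => ∑ n ∈ Finset.Icc 1 N, |p (n + 1) - p n|) =o[atTop]
      (fun N : ℕ => ∑ n ∈ Finset.Icc 1 N, p n))
    (h3 : ∀ ε : ℝ, 0 < ε → ε < 1 → p =O[atTop] (fun n : ℕ => 1 / (n : ℝ) ^ (1 - ε)))
    {Ω : Type*} [MeasurableSpace Ω] {P : Measure Ω} [IsProbabilityMeasure P]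
    {ξ : ℕ → Ω → ℝ} (hmeas : ∀ n : ℕ, 1 ≤ n → Measurable (ξ n))
    (hindep : iIndepFun (fun n : ℕ+ => ξ (n : ℕ)) P)
    (hone : ∀ n : ℕ, 1 ≤ n → P.real {ω | ξ n ω = 1} = p n) :
    ∀ᵐ ω ∂P,
      (randomSet ξ ω).Infinite ∧
      IsKazhdanSeq (randomSeq ξ ω) ∧
      (∀ r : ℕ, 1 ≤ r → HasDensityZero (signedSums (Set.range (randomSeq ξ ω)) r)) ∧
      ¬ IsAsymptoticBasis (Set.range (randomSeq ξ ω)) := by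
  obtain ⟨hE, hind⟩ := hindep.iIndepSet_pos_preimage hmeas
  set E : ℕ → Set Ω := fun n => {ω | 1 ≤ n ∧ ξ n ω = 1} with hEdef
  have hEp : ∀ n, 1 ≤ n → P.real (E n) = p n := fun n hn => by
    rw [← hone n hn]; simp [hEdef, hn]
  have hE0 : P.real (E 0) = 0 := by simp [hEdef]
  have hsum : ∀ N, ∑ n ∈ Finset.Icc 1 N, P.real (E n) = ∑ n ∈ Finset.Icc 1 N, p n := fun N =>
    Finset.sum_congr rfl fun n hn => hEp n (Finset.mem_Icc.1 hn).1
  have hvar : ∀ N, ∑ n ∈ Finset.Icc 1 N, |P.real (E (n + 1)) - P.real (E n)|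
      = ∑ n ∈ Finset.Icc 1 N, |p (n + 1) - p n| := fun N =>
    Finset.sum_congr rfl fun n hn => by
      rw [hEp n (Finset.mem_Icc.1 hn).1, hEp (n + 1) (by omega)]
  have hlog' : Tendsto (fun N : ℕ => (1 / Real.log (N : ℝ)) * ∑ n ∈ Finset.Icc 1 N, P.real (E n))
      atTop atTop := h1.congr fun N => by rw [hsum]
  have hvar' : (fun N : ℕ => ∑ n ∈ Finset.Icc 1 N, |P.real (E (n + 1)) - P.real (E n)|) =o[atTop]
      (fun N : ℕ => ∑ n ∈ Finset.Icc 1 N, P.real (E n)) := by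
    rwa [funext hsum, funext hvar]
  filter_upwards [hind.ae_isKazhdanSet_and_hasDensityZero hE hlog' hvar'
    (fun ε hε0 hε1 => exists_le_mul_add_one_rpow hE0 hEp hε0 hε1 (h3 ε hε0 hε1))]
    with ω ⟨hinf, hkaz, hdens⟩
  change (randomSet ξ ω).Infinite at hinf
  change IsKazhdanSet ((fun n : ℕ => (n : ℤ)) '' randomSet ξ ω) at hkaz
  change ∀ r : ℕ, 1 ≤ r →
    HasDensityZero (signedSums ((fun n : ℕ => (n : ℤ)) '' randomSet ξ ω) r) at hdens
  -- Infinitude matters here: for a finite set `Nat.nth` takes the default value 0 beyond the last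
  -- element, so 0 would join the range.
  have hrange : Set.range (randomSeq ξ ω) = (fun n : ℕ => (n : ℤ)) '' randomSet ξ ω := by
    have : Set.range (Nat.nth fun n => n ∈ randomSet ξ ω) = randomSet ξ ω :=
      Nat.range_nth_of_infinite hinf
    conv_rhs => rw [← this]
    rw [← Set.range_comp]
    rfl
  rw [IsKazhdanSeq, hrange]
  exact ⟨hinf, hkaz, hdens, not_isAsymptoticBasis_of_hasDensityZero hdens⟩

/-! ### An explicit choice of probabilities and the existence statement -/

/-- Probabilities satisfying the hypotheses of the main theorem. -/
noncomputable def logProbability (n : ℕ) : ℝ :=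
  Real.log ((n : ℝ) + 2) / ((n : ℝ) + 2)

theorem logProbability_pos (n : ℕ) : 0 < logProbability n :=
  div_pos (Real.log_pos (by linarith [n.cast_nonneg (α := ℝ)])) (by positivity)

theorem logProbability_lt_one (n : ℕ) : logProbability n < 1 := by
  rw [logProbability, div_lt_one (by positivity)]
  have := Real.log_le_sub_one_of_pos (show (0 : ℝ) < (n : ℝ) + 2 by positivity)
  linarith

theorem logProbability_succ_le {n : ℕ} (hn : 1 ≤ n) :
    logProbability (n + 1) ≤ logProbability n := by
  have hn' : (1 : ℝ) ≤ n := by exact_mod_cast hn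
  have he : Real.exp 1 ≤ (n : ℝ) + 2 := by linarith [Real.exp_one_lt_d9]
  refine Real.log_div_self_antitoneOn ?_ ?_ ?_
  · exact he
  · change Real.exp 1 ≤ ((n + 1 : ℕ) : ℝ) + 2
    push_cast; linarith
  · push_cast; linarith

/-- Discrete comparison with the integral of (log x)/x. The divisor 3 in place of 2 leaves room for
the step: with b = log(N+3) ≥ 1 and a = log(N+4) ≤ b + 1, one has (a + b)/3 ≤ b. -/
theorem le_sum_logProbability (N : ℕ) :
    (Real.log ((N : ℝ) + 3) ^ 2 - Real.log 3 ^ 2) / 3 ≤ ∑ n ∈ Finset.Icc 1 N, logProbability n := by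
  induction N with
  | zero => simp
  | succ N ih =>
    rw [Finset.sum_Icc_succ_top (by omega)]
    have hN : (0 : ℝ) ≤ N := N.cast_nonneg
    set b := Real.log ((N : ℝ) + 3) with hb
    set a := Real.log ((N : ℝ) + 1 + 3) with ha
    have hb1 : 1 ≤ b := by
      rw [hb, Real.le_log_iff_exp_le (by linarith)]
      linarith [Real.exp_one_lt_d9]
    have hab : a - b ≤ 1 / ((N : ℝ) + 3) := by
      rw [ha, hb, ← Real.log_div (by positivity) (by positivity)]
      refine (Real.log_le_sub_one_of_pos (by positivity)).trans (le_of_eq ?_)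
      field_simp; ring
    have hba : b ≤ a := Real.log_le_log (by positivity) (by linarith)
    have h1 : 1 / ((N : ℝ) + 3) ≤ 1 := by
      rw [div_le_one (by positivity)]; linarith
    have hp : logProbability (N + 1) = 1 / ((N : ℝ) + 3) * b := by
      rw [logProbability, hb]; push_cast
      rw [show (N : ℝ) + 1 + 2 = N + 3 by ring]; ring
    have hstep : (a ^ 2 - b ^ 2) / 3 ≤ logProbability (N + 1) := by
      rw [hp]
      calc (a ^ 2 - b ^ 2) / 3 = (a - b) * ((a + b) / 3) := by ring
        _ ≤ 1 / ((N : ℝ) + 3) * b :=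
          mul_le_mul hab (by linarith) (by linarith) (by positivity)
    push_cast
    linarith

theorem tendsto_sum_logProbability :
    Tendsto (fun N : ℕ => (1 / Real.log (N : ℝ)) * ∑ n ∈ Finset.Icc 1 N, logProbability n)
      atTop atTop := by
  have hlog : Tendsto (fun N : ℕ => (Real.log (N : ℝ) - 4) / 3) atTop atTop :=
    (tendsto_atTop_add_const_right _ (-4)
      (Real.tendsto_log_atTop.comp tendsto_natCast_atTop_atTop)).atTop_div_const (by norm_num)
  refine tendsto_atTop_mono' _ ?_ hlog
  filter_upwards [eventually_ge_atTop 3] with N hN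
  have h3 : (3 : ℝ) ≤ N := by exact_mod_cast hN
  have hl : 1 ≤ Real.log N := by
    rw [Real.le_log_iff_exp_le (by linarith)]
    linarith [Real.exp_one_lt_d9]
  have hl3 : Real.log 3 ≤ 2 := by linarith [Real.log_le_sub_one_of_pos (show (0 : ℝ) < 3 by norm_num)]
  have hl30 : 0 ≤ Real.log 3 := Real.log_nonneg (by norm_num)
  have hle : Real.log N ≤ Real.log ((N : ℝ) + 3) := Real.log_le_log (by linarith) (by linarith)
  have := le_sum_logProbability N
  rw [one_div, inv_mul_eq_div, le_div_iff₀ (by linarith)]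
  nlinarith

/-- The probabilities decrease from n = 1 on, as n + 2 ≥ 3 > e, so the variation telescopes to a
bounded quantity while the sum diverges. -/
theorem isLittleO_sum_abs_sub_logProbability :
    (fun N : ℕ => ∑ n ∈ Finset.Icc 1 N, |logProbability (n + 1) - logProbability n|) =o[atTop]
      (fun N : ℕ => ∑ n ∈ Finset.Icc 1 N, logProbability n) := by
  have htel : ∀ N : ℕ, ∑ n ∈ Finset.Icc 1 N, |logProbability (n + 1) - logProbability n|
      = logProbability 1 - logProbability (N + 1) := by
    intro N
    induction N with
    | zero => simp
    | succ N ih =>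
      rw [Finset.sum_Icc_succ_top (by omega), ih, abs_sub_comm, abs_of_nonneg
        (sub_nonneg.2 (logProbability_succ_le (by omega)))]
      ring
  have hdiv : Tendsto (fun N : ℕ => ∑ n ∈ Finset.Icc 1 N, logProbability n) atTop atTop := by
    refine tendsto_atTop_mono' _ ?_ tendsto_sum_logProbability
    filter_upwards [eventually_ge_atTop 3] with N hN
    have h3 : (3 : ℝ) ≤ N := by exact_mod_cast hN
    have hl : 1 ≤ Real.log N := by
      rw [Real.le_log_iff_exp_le (by linarith)]
      linarith [Real.exp_one_lt_d9]
    refine mul_le_of_le_one_left (Finset.sum_nonneg fun n _ => (logProbability_pos n).le) ?_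
    rw [one_div]
    exact inv_le_one_of_one_le₀ hl
  refine IsBigO.trans_isLittleO (g := fun _ => (1 : ℝ)) (IsBigO.of_bound 1 ?_)
    (isLittleO_const_left.2 (Or.inr (tendsto_norm_atTop_atTop.comp hdiv)))
  refine Eventually.of_forall fun N => ?_
  rw [Real.norm_of_nonneg (Finset.sum_nonneg fun _ _ => abs_nonneg _), htel, norm_one, mul_one]
  linarith [logProbability_lt_one 1, logProbability_pos (N + 1)]

theorem isBigO_logProbability {ε : ℝ} (hε0 : 0 < ε) (hε1 : ε < 1) :
    logProbability =O[atTop] (fun n : ℕ => 1 / (n : ℝ) ^ (1 - ε)) := by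
  refine IsBigO.of_bound (1 / ε) ?_
  filter_upwards [eventually_ge_atTop 1] with n hn
  have hn' : (1 : ℝ) ≤ n := by exact_mod_cast hn
  have hx : (0 : ℝ) < (n : ℝ) + 2 := by positivity
  rw [Real.norm_of_nonneg (logProbability_pos n).le, Real.norm_of_nonneg (by positivity)]
  calc logProbability n ≤ (((n : ℝ) + 2) ^ ε / ε) / ((n : ℝ) + 2) := by
        rw [logProbability]
        gcongr
        exact Real.log_le_rpow_div hx.le hε0
    _ = 1 / ε * (1 / ((n : ℝ) + 2) ^ (1 - ε)) := by
        rw [Real.rpow_sub hx, Real.rpow_one]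
        field_simp
    _ ≤ 1 / ε * (1 / (n : ℝ) ^ (1 - ε)) := by
        gcongr
        linarith

/-- The law of a `{0, 1}`-valued real random variable. -/
noncomputable def bernoulliLaw (p : ℝ) : Measure ℝ :=
  ENNReal.ofReal p • Measure.dirac 1 + ENNReal.ofReal (1 - p) • Measure.dirac 0

theorem isProbabilityMeasure_bernoulliLaw {p : ℝ} (h0 : 0 ≤ p) (h1 : p ≤ 1) :
    IsProbabilityMeasure (bernoulliLaw p) := by
  constructor
  simp only [bernoulliLaw, Measure.add_apply, Measure.smul_apply, measure_univ, smul_eq_mul,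
    mul_one]
  rw [← ENNReal.ofReal_add h0 (sub_nonneg.2 h1)]
  simp

theorem bernoulliLaw_real_singleton_one {p : ℝ} (h0 : 0 ≤ p) :
    (bernoulliLaw p).real {1} = p := by
  simp [bernoulliLaw, measureReal_def, h0]

/-- There is a Kazhdan set which is not an asymptotic basis. -/
theorem exists_isKazhdanSet_not_isAsymptoticBasis :
    ∃ Q : Set ℤ, IsKazhdanSet Q ∧ ¬ IsAsymptoticBasis Q := by
  have hprob : ∀ n, IsProbabilityMeasure (bernoulliLaw (logProbability n)) := fun n =>
    isProbabilityMeasure_bernoulliLaw (logProbability_pos n).le (logProbability_lt_one n).le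
  -- The coordinates of the product space are the required independent variables; any point outside
  -- the null set gives an example.
  set P : Measure (ℕ → ℝ) := Measure.infinitePi fun n => bernoulliLaw (logProbability n) with hP
  have hindep : iIndepFun (fun (n : ℕ+) (x : ℕ → ℝ) => x (n : ℕ)) P :=
    (iIndepFun_infinitePi (P := fun n => bernoulliLaw (logProbability n))
      (X := fun _ x => x) (fun _ => measurable_id)).precomp PNat.coe_injective
  have hone : ∀ n : ℕ, 1 ≤ n → P.real {ω | ω n = 1} = logProbability n := by
    intro n _
    have hmap := Measure.infinitePi_map_eval (fun n => bernoulliLaw (logProbability n)) n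
    have : P {ω | ω n = 1} = bernoulliLaw (logProbability n) {1} := by
      rw [← hmap, Measure.map_apply (measurable_pi_apply n) (measurableSet_singleton 1)]
      rfl
    rw [measureReal_def, this, ← measureReal_def,
      bernoulliLaw_real_singleton_one (logProbability_pos n).le]
  obtain ⟨ω, -, hkaz, -, hbasis⟩ := (ae_randomSeq tendsto_sum_logProbability
    isLittleO_sum_abs_sub_logProbability (fun ε => isBigO_logProbability)
    (ξ := fun n (x : ℕ → ℝ) => x n) (fun n _ => measurable_pi_apply n) hindep hone).exists
  exact ⟨_, hkaz, hbasis⟩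

theorem mainTheorem6 :
    (∀ (p : ℕ → ℝ) (_hp : ∀ n : ℕ, 1 ≤ n → 0 < p n ∧ p n < 1)
      (_h1 : Tendsto (fun N : ℕ => (1 / Real.log (N : ℝ)) * ∑ n ∈ Finset.Icc 1 N, p n)
        atTop atTop)
      (_h2 : (fun N : ℕ => ∑ n ∈ Finset.Icc 1 N, |p (n + 1) - p n|) =o[atTop]
        (fun N : ℕ => ∑ n ∈ Finset.Icc 1 N, p n))
      (_h3 : ∀ ε : ℝ, 0 < ε → ε < 1 →
        p =O[atTop] (fun n : ℕ => 1 / (n : ℝ) ^ (1 - ε)))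
      (Ω : Type*) [MeasurableSpace Ω] (P : Measure Ω) [IsProbabilityMeasure P]
      (ξ : ℕ → Ω → ℝ) (_hmeas : ∀ n : ℕ, 1 ≤ n → Measurable (ξ n))
      (_hindep : iIndepFun (fun n : ℕ+ => ξ (n : ℕ)) P)
      (_hone : ∀ n : ℕ, 1 ≤ n → P.real {ω | ξ n ω = 1} = p n)
      (_hzero : ∀ n : ℕ, 1 ≤ n → P.real {ω | ξ n ω = 0} = 1 - p n),
      ∀ᵐ ω ∂P,
        (randomSet ξ ω).Infinite ∧
        IsKazhdanSeq (randomSeq ξ ω) ∧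
        (∀ r : ℕ, 1 ≤ r → HasDensityZero (signedSums (Set.range (randomSeq ξ ω)) r)) ∧
        ¬ IsAsymptoticBasis (Set.range (randomSeq ξ ω))) ∧
    ∃ Q : Set ℤ, IsKazhdanSet Q ∧ ¬ IsAsymptoticBasis Q := by
  refine ⟨?_, exists_isKazhdanSet_not_isAsymptoticBasis⟩
  intro p _ h1 h2 h3 Ω _ P _ ξ hmeas hindep hone _
  exact ae_randomSeq h1 h2 h3 hmeas hindep hone
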